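/- **Finslerian Beltrami theorem.** Let $M$ be a connected smooth manifold of dimension $n>2$, $T_0M=TM\setminus\{0\}$. A *Finsler metric* on $M$ is a continuous function $F:TM\to\mathbb R$, positive and smooth on $T_0M$, with $F(x,\lambda y)=\lambda F(x,y)$ for $\lambda>0$, whose fibre Hessian $g_{ij}=\frac12\,\partial^2F^2/\partial y^i\partial y^j$ is nondegenerate on $T_0M$. Let $J=dx^i\otimes\partial/\partial y^i$ be the vertical endomorphism and $\mathcal C=y^i\,\partial/\partial y^i$ the Liouville vector field. The *geodesic spray* $S$ of $F$ is the unique vector field on $T_0M$ with $i_S\,dd_JF^2=-dF^2$; the *horizontal projector* is $h=\frac12(\mathrm{Id}-[S,J])$, and the *curvature* is $R=\frac12[h,h]$ (Frölicher–Nijenhuis brackets), with components given by $R(\delta_j,\delta_k)=R^i_{jk}\,\partial/\partial y^i$, where $\delta_j=h(\partial/\partial x^j)$. The *flag curvature* of the flag $\operatorname{span}\{y,X\}$ with flagpole $y$, for $(x,y)\in T_0M$ and $X\in T_xM$ linearly independent of $y$, is $$\kappa_{(x,y)}(y\wedge X)=\frac{X^ig_{il}R^l_{jk}y^jX^k}{g_{ij}y^iy^j\,g_{ij}X^iX^j-(g_{ij}y^iX^j)^2}.$$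 $F$ has *constant flag curvature* if this is one and the same constant for all $(x,y)\in T_0M$ and all $X$. Let $F$ and $\widetilde F$ be two Finsler metrics on $M$ that are projectively related, their geodesic sprays satisfying $\widetilde S=S-2P\,\mathcal C$ on $T_0M$, where the projective factor $P\in C^\infty(T_0M)$ is positively $1$-homogeneous in the fibre coordinates. Assume that one of the two metrics has constant flag curvature. Then the other one has constant flag curvature if and only if $P$ satisfies Hamel's equation $d_hd_JP=0$ on $T_0M$, where $h$ is the horizontal projector of $F$, $d_JP=dP\circ J$, and $d_h\alpha=i_h\,d\alpha-d(\alpha\circ h)$ for a $1$-form $\alpha$. -/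

import Mathlib

open scoped Manifold ContDiff

noncomputable section

namespace Finsler

/-! ### Calculus in induced coordinates

A point `z = (x, y)` of `E × E` carries the coordinates of the base point and of the
fibre.  Forms and vector-valued forms on (open subsets of) `E × E` are functions of `z`. -/

section Coordinates

variable {E : Type*} [NormedAddCommGroup E] [NormedSpace ℝ E]

/-- The vertical endomorphism `J = dxⁱ ⊗ ∂/∂yⁱ`, that is `J (a, b) = (0, a)`. -/
def vertEnd (E : Type*) [NormedAddCommGroup E] [NormedSpace ℝ E] : E × E →L[ℝ] E × E :=
  (ContinuousLinearMap.inr ℝ E E).comp (ContinuousLinearMap.fst ℝ E E)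

/-- The Liouville (dilation) vector field `𝒞 = yⁱ ∂/∂yⁱ`. -/
def liouville (z : E × E) : E × E := (0, z.2)

/-- Exterior derivative of a 1-form: `dα(u, w) = D_u α (w) - D_w α (u)`. -/
def extD (α : E × E → (E × E →L[ℝ] ℝ)) (z : E × E) : E × E →L[ℝ] E × E →L[ℝ] ℝ :=
  fderiv ℝ α z - (fderiv ℝ α z).flip

/-- The 1-form `d_J f = df ∘ J`. -/
def dJ (f : E × E → ℝ) (z : E × E) : E × E →L[ℝ] ℝ :=
  (fderiv ℝ f z).comp (vertEnd E)

/-- For a field `h` of endomorphisms and a 1-form `α`, the 2-form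
`d_h α = [i_h, d] α = i_h dα - d (i_h α)`, where
`i_h β (u, w) = β (h u, w) + β (u, h w)` for 2-forms and `i_h α = α ∘ h` for 1-forms. -/
def dEnd (h : E × E → (E × E →L[ℝ] E × E)) (α : E × E → (E × E →L[ℝ] ℝ))
    (z u w : E × E) : ℝ :=
  extD α z (h z u) w + extD α z u (h z w) - extD (fun z' => (α z').comp (h z')) z u w

/-- The geodesic spray of a Finsler metric with `F² = L`: the unique solution `S` of
`i_S dd_J L = - dL`.  (`ContinuousLinearMap.inverse` is the inverse of the linear map
`u ↦ i_u dd_J L`, which is invertible where `L` has a nondegenerate fibre Hessian.) -/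
def spray (L : E × E → ℝ) (z : E × E) : E × E :=
  (extD (dJ L) z).inverse (-fderiv ℝ L z)

/-- The horizontal projector `h = ½ (Id - [S, J])`; see `horProj_apply`. -/
def horProj (S : E × E → E × E) (z : E × E) : E × E →L[ℝ] E × E :=
  (1 / 2 : ℝ) • (ContinuousLinearMap.id ℝ (E × E)
    - ((vertEnd E).comp (fderiv ℝ S z) - (fderiv ℝ S z).comp (vertEnd E)))

/-- `h X = ½ (X - [S, J] X)` with `[S, J] X = [S, J X] - J [S, X]`, for constant `X`. -/
theorem horProj_apply (S : E × E → E × E) (z w : E × E) :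
    horProj S z w = (1 / 2 : ℝ) • (w
      - (VectorField.lieBracket ℝ S (fun _ => vertEnd E w) z
        - vertEnd E (VectorField.lieBracket ℝ S (fun _ => w) z))) := by
  simp [horProj, VectorField.lieBracket]
  abel

/-- The vector field `½ [h, h] (X, Y) = [hX, hY] + h²[X, Y] - h[hX, Y] - h[X, hY]`
(Frölicher–Nijenhuis bracket) for a field `h` of endomorphisms and vector fields `X`, `Y`. -/
def halfBracket (h : E × E → (E × E →L[ℝ] E × E)) (X Y : E × E → E × E) (z : E × E) :
    E × E :=
  VectorField.lieBracket ℝ (fun z' => h z' (X z')) (fun z' => h z' (Y z')) z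
    + h z (h z (VectorField.lieBracket ℝ X Y z))
    - h z (VectorField.lieBracket ℝ (fun z' => h z' (X z')) Y z)
    - h z (VectorField.lieBracket ℝ X (fun z' => h z' (Y z')) z)

/-- The value at `z` of the curvature tensor `R = ½ [h, h]` on the tangent vectors `u`, `w`,
computed by extending them to constant vector fields. -/
def curvature (h : E × E → (E × E →L[ℝ] E × E)) (z u w : E × E) : E × E :=
  halfBracket h (fun _ => u) (fun _ => w) z

/-- The metric tensor `g_{ij} = ½ ∂²F²/∂yⁱ∂yʲ`, where `L = F²`. -/
def metricTensor (L : E × E → ℝ) (z : E × E) (u w : E) : ℝ :=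
  (1 / 2) * fderiv ℝ (fderiv ℝ L) z (0, u) (0, w)

/-- The flag curvature, at `z = (x, y)`, of the flag `span {y, X}` with flagpole `y`, for `L = F²`:
`Xⁱ g_{il} Rˡ_{jk} yʲ Xᵏ / (g(y,y) g(X,X) - g(y,X)²)`.  Here `Rˡ_{jk} yʲ Xᵏ` are the components
of the vertical vector `R (S, X̂)`, with `X̂ = (X, 0)` a lift of `X`. -/
def flagCurvature (L : E × E → ℝ) (z : E × E) (X : E) : ℝ :=
  metricTensor L z X (curvature (horProj (spray L)) z (spray L z) (X, 0)).2 /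
    (metricTensor L z z.2 z.2 * metricTensor L z X X - metricTensor L z z.2 X ^ 2)

end Coordinates

/-! ### Finsler metrics on a manifold -/

section Manifolds

variable {n : ℕ} {M : Type*} [TopologicalSpace M] [ChartedSpace (EuclideanSpace ℝ (Fin n)) M]
  [IsManifold (𝓡 n) ∞ M]

/-- The induced coordinates `(xⁱ, yⁱ)` on `TM` coming from the chart `(xⁱ)` of `M` at `p`. -/
def inducedChart (p : M) :
    PartialEquiv (TangentBundle (𝓡 n) M)
      (EuclideanSpace ℝ (Fin n) × EuclideanSpace ℝ (Fin n)) :=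
  extChartAt (𝓡 n).tangent (⟨p, 0⟩ : TangentBundle (𝓡 n) M)

/-- A function on `TM` expressed in the induced coordinates. -/
def inCoords (f : TangentBundle (𝓡 n) M → ℝ) (p : M) :
    EuclideanSpace ℝ (Fin n) × EuclideanSpace ℝ (Fin n) → ℝ :=
  fun z => f ((inducedChart p).symm z)

/-- The coordinate expression of `F²`. -/
def sqInCoords (F : TangentBundle (𝓡 n) M → ℝ) (p : M) :
    EuclideanSpace ℝ (Fin n) × EuclideanSpace ℝ (Fin n) → ℝ :=
  fun z => inCoords F p z ^ 2

/-- The set of coordinates `(x, y)`, `y ≠ 0`, of the points of `T₀M` over the chart of `M`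
at `p`. -/
def slitDomain (n : ℕ) {M : Type*} [TopologicalSpace M]
    [ChartedSpace (EuclideanSpace ℝ (Fin n)) M] [IsManifold (𝓡 n) ∞ M] (p : M) :
    Set (EuclideanSpace ℝ (Fin n) × EuclideanSpace ℝ (Fin n)) :=
  {z | z ∈ (inducedChart (n := n) p).target ∧ z.2 ≠ 0}

/-- Smoothness on `T₀M = TM \ {0}`. -/
def SmoothOnSlit (f : TangentBundle (𝓡 n) M → ℝ) : Prop :=
  ContMDiffOn (𝓡 n).tangent 𝓘(ℝ, ℝ) ∞ f {v | v.2 ≠ 0}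

/-- Positive 1-homogeneity in the fibres over `T₀M`. -/
def PosHomogeneous (f : TangentBundle (𝓡 n) M → ℝ) : Prop :=
  ∀ (x : M) (y : TangentSpace (𝓡 n) x), y ≠ 0 → ∀ c : ℝ, 0 < c →
    f ⟨x, c • y⟩ = c * f ⟨x, y⟩

/-- Finsler metrics. -/
structure IsFinslerMetric (F : TangentBundle (𝓡 n) M → ℝ) : Prop where
  continuous : Continuous F
  pos : ∀ v : TangentBundle (𝓡 n) M, v.2 ≠ 0 → 0 < F v
  smooth : SmoothOnSlit F
  homogeneous : PosHomogeneous F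
  nondegenerate : ∀ p : M, ∀ z ∈ slitDomain n p, ∀ u : EuclideanSpace ℝ (Fin n),
    (∀ w : EuclideanSpace ℝ (Fin n), metricTensor (sqInCoords F p) z u w = 0) → u = 0

/-- The flag curvature has the same value at all points of `T₀M`, on all flags. -/
def HasConstantFlagCurvature (F : TangentBundle (𝓡 n) M → ℝ) : Prop :=
  ∃ κ : ℝ, ∀ p : M, ∀ z ∈ slitDomain n p, ∀ X : EuclideanSpace ℝ (Fin n),
    LinearIndependent ℝ ![z.2, X] → flagCurvature (sqInCoords F p) z X = κ

/-- `F` and `F'` are projectively related with projective factor `P`: the function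
`P ∈ C^∞(T₀M)` is positively 1-homogeneous and the geodesic sprays satisfy `S' = S - 2P𝒞`. -/
structure IsProjectiveFactor (F F' P : TangentBundle (𝓡 n) M → ℝ) : Prop where
  smooth : SmoothOnSlit P
  homogeneous : PosHomogeneous P
  spray_eq : ∀ p : M, ∀ z ∈ slitDomain n p,
    spray (sqInCoords F' p) z =
      spray (sqInCoords F p) z - (2 * inCoords P p z) • liouville z

/-- Hamel's equation `d_h d_J P = 0` on `T₀M`, with `h` the horizontal projector of `F`. -/
def HamelEquation (F P : TangentBundle (𝓡 n) M → ℝ) : Prop :=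
  ∀ p : M, ∀ z ∈ slitDomain n p, ∀ u w : EuclideanSpace ℝ (Fin n) × EuclideanSpace ℝ (Fin n),
    dEnd (horProj (spray (sqInCoords F p))) (dJ (inCoords P p)) z u w = 0

end Manifolds

end Finsler

end

/-!
Why the theorem holds. In induced coordinates write a spray as `(y, s)`, with horizontal lifts
`δₐ = (a, Γ a)` where `Γ a = ½ ∂s/∂y (a)`, and write `R(a, b)` for the vertical vector
`R(δₐ, δ_b)`.

For a Finsler metric the Jacobi endomorphism `b ↦ R(y, b)` is self-adjoint, so constant flag
curvature `κ` means `R(y, b) = κ (F² b - g(y, b) y)`; the vertical Bianchi identity recovers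
`R(a, b) = κ (g(y, a) b - g(y, b) a)` (`curv_eq_of_flagCurvature_eq`). Under `s' = s - 2 P y` the
curvature changes by
`R'(a, b) = R(a, b) - ω(a, b) y + θ(a) b - θ(b) a`, with `ω = d_h d_J P` and
`θ(a) = P Pₐ - δₐ P` (`IsProjectiveOn.curv_eq`).

If both metrics have constant flag curvature, this gives `φ(a) b - φ(b) a + ω(a, b) y = 0` for a
1-form `φ`. In dimension at least three `b` can be chosen outside `span {a, y}`, so `φ = 0` and then
`ω = 0`: Hamel's equation holds.

If `F` has constant flag curvature `κ` and `ω = 0`, then `R'(a, b) = σ(a) b - σ(b) a`. Since the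
curvature `R'` preserves `F̃`, the 1-form `σ` is `K g̃(y, ·)`, with
`K = (κ F² + P² - S P) / F̃²`, and `K` is the flag curvature of `F̃` at the point. Hamel's equation
contracted with the spray makes `K` constant along the fibres
(`IsProjectiveOn.fderiv_spray_of_hamel`), and the horizontal Bianchi identity makes it locally
constant (`IsFinslerOn.fderiv_eq_zero_of_isotropic`). The geodesic spray is natural under changes of
coordinates (`spray_tangMap`), so the local functions `K` agree on overlaps, and `M` is connected.

The two metrics may be exchanged, because `P ↦ -P` preserves Hamel's equation. The denominators of
flag curvatures do not vanish because a positive Finsler metric with nondegenerate fibre Hessian has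
a positive definite one (`hess_pos_of_nondegenerate`).
-/

noncomputable section

namespace Finsler

/-! ### Differentiating identities that hold on an open set -/

section Calculus

variable {V W : Type*} [NormedAddCommGroup V] [NormedSpace ℝ V]
  [NormedAddCommGroup W] [NormedSpace ℝ W] {U : Set V}

theorem contDiffOn_fderiv {f : V → W} (hU : IsOpen U) (hf : ContDiffOn ℝ ∞ f U) :
    ContDiffOn ℝ ∞ (fderiv ℝ f) U :=
  hf.fderiv_of_isOpen hU (by simp)

theorem differentiableAt_of_smooth {f : V → W} (hU : IsOpen U) (hf : ContDiffOn ℝ ∞ f U)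
    {z : V} (hz : z ∈ U) : DifferentiableAt ℝ f z :=
  (hf.contDiffAt (hU.mem_nhds hz)).differentiableAt (by simp)

theorem fderiv_congr_on {f g : V → W} (hU : IsOpen U) (h : ∀ z ∈ U, f z = g z) {z : V}
    (hz : z ∈ U) : fderiv ℝ f z = fderiv ℝ g z :=
  Filter.EventuallyEq.fderiv_eq (Filter.eventually_of_mem (hU.mem_nhds hz) h)

theorem fderiv_fderiv_comm {f : V → W} (hU : IsOpen U) (hf : ContDiffOn ℝ ∞ f U)
    {z : V} (hz : z ∈ U) (u v : V) :
    fderiv ℝ (fderiv ℝ f) z u v = fderiv ℝ (fderiv ℝ f) z v u :=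
  ((hf.contDiffAt (hU.mem_nhds hz)).isSymmSndFDerivAt
    (by simp only [minSmoothness_of_isRCLikeNormedField]; exact ENat.LEInfty.out)) u v

theorem fderiv_apply_field {X : Type*} [NormedAddCommGroup X] [NormedSpace ℝ X]
    {A : V → X →L[ℝ] W} {v : V → X} {z : V}
    (hA : DifferentiableAt ℝ A z) (hv : DifferentiableAt ℝ v z) (u : V) :
    fderiv ℝ (fun z' => A z' (v z')) z u = fderiv ℝ A z u (v z) + A z (fderiv ℝ v z u) := by
  rw [fderiv_clm_apply hA hv]
  simp [add_comm]

theorem fderiv_apply_const {X : Type*} [NormedAddCommGroup X] [NormedSpace ℝ X]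
    {A : V → X →L[ℝ] W} {z : V} (hA : DifferentiableAt ℝ A z) (x : X) (u : V) :
    fderiv ℝ (fun z' => A z' x) z u = fderiv ℝ A z u x := by
  rw [fderiv_apply_field hA (differentiableAt_const x)]
  simp

theorem contDiff_flip : ContDiff ℝ ∞ (fun A : V →L[ℝ] V →L[ℝ] W => A.flip) := by
  refine IsBoundedLinearMap.contDiff ⟨⟨fun _ _ => rfl, fun _ _ => rfl⟩, 1, one_pos, fun A => ?_⟩
  simp

end Calculus

section Fibre

variable {E W : Type*} [NormedAddCommGroup E] [NormedSpace ℝ E]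
  [NormedAddCommGroup W] [NormedSpace ℝ W] {U : Set (E × E)}

theorem fderiv_liouville (z u : E × E) : fderiv ℝ (liouville (E := E)) z u = (0, u.2) := by
  have : liouville (E := E)
      = ((ContinuousLinearMap.inr ℝ E E).comp (ContinuousLinearMap.snd ℝ E E)) := by
    ext z <;> simp [liouville]
  rw [this, ContinuousLinearMap.fderiv]
  simp

theorem differentiableAt_liouville (z : E × E) : DifferentiableAt ℝ (liouville (E := E)) z := by
  have : liouville (E := E)
      = ((ContinuousLinearMap.inr ℝ E E).comp (ContinuousLinearMap.snd ℝ E E)) := by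
    ext z <;> simp [liouville]
  rw [this]
  exact ContinuousLinearMap.differentiableAt _

/-- The derivative of Euler's identity `𝒞 f = k f` for functions homogeneous in the fibre. -/
theorem euler_fderiv {f : E × E → W} {k : ℝ} (hU : IsOpen U) (hf : ContDiffOn ℝ ∞ f U)
    (he : ∀ z ∈ U, fderiv ℝ f z (liouville z) = k • f z) {z : E × E} (hz : z ∈ U) (u : E × E) :
    fderiv ℝ (fderiv ℝ f) z u (liouville z) = k • fderiv ℝ f z u - fderiv ℝ f z (0, u.2) := by
  have h := fderiv_congr_on hU he hz
  have h1 := DFunLike.congr_fun h u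
  rw [fderiv_apply_field (differentiableAt_of_smooth hU (contDiffOn_fderiv hU hf) hz)
    (differentiableAt_liouville z), fderiv_liouville,
    fderiv_fun_const_smul (differentiableAt_of_smooth hU hf hz)] at h1
  exact eq_sub_of_add_eq h1

end Fibre

/-! ### Connection and curvature of a spray -/

section Spray

variable {E : Type*} [NormedAddCommGroup E] [NormedSpace ℝ E] {U : Set (E × E)}

/-- The linear map `a ↦ ½ ∂s/∂y (a)`: for the spray `(y, s) = (y, -2 G)` it is minus the
nonlinear connection `Nⁱⱼ = ∂Gⁱ/∂yʲ`. -/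
def connMap (s : E × E → E) (z : E × E) : E →L[ℝ] E :=
  (1 / 2 : ℝ) • (fderiv ℝ s z).comp (ContinuousLinearMap.inr ℝ E E)

/-- The horizontal lift `aʲ ↦ aʲ δⱼ` of the spray `(y, s)`. -/
def hlift (s : E × E → E) (z : E × E) : E →L[ℝ] E × E :=
  (ContinuousLinearMap.id ℝ E).prod (connMap s z)

/-- The components `Rⁱⱼₖ aʲ bᵏ` of the curvature of the spray `(y, s)`. -/
def curv (s : E × E → E) (z : E × E) (a b : E) : E :=
  fderiv ℝ (connMap s) z (hlift s z a) b - fderiv ℝ (connMap s) z (hlift s z b) a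

/-- The vector field `(y, s)` is a smooth spray on `U`: its second component `s` is
2-homogeneous in the fibre, in the infinitesimal form of Euler's identity. -/
structure IsSprayOn (U : Set (E × E)) (s : E × E → E) : Prop where
  isOpen : IsOpen U
  smooth : ContDiffOn ℝ ∞ s U
  euler : ∀ z ∈ U, fderiv ℝ s z (liouville z) = (2 : ℝ) • s z

theorem connMap_apply (s : E × E → E) (z : E × E) (a : E) :
    connMap s z a = (1 / 2 : ℝ) • fderiv ℝ s z (0, a) := by
  simp [connMap]

theorem hlift_apply (s : E × E → E) (z : E × E) (a : E) : hlift s z a = (a, connMap s z a) := rfl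

theorem curv_swap (s : E × E → E) (z : E × E) (a b : E) : curv s z b a = -curv s z a b := by
  simp [curv]

theorem curv_add_left (s : E × E → E) (z : E × E) (a a' b : E) :
    curv s z (a + a') b = curv s z a b + curv s z a' b := by
  simp [curv]; abel

theorem curv_smul_left (s : E × E → E) (z : E × E) (c : ℝ) (a b : E) :
    curv s z (c • a) b = c • curv s z a b := by
  simp [curv, smul_sub]

theorem fderiv_prod_zero {s : E × E → E} {z : E × E} (hs : DifferentiableAt ℝ s z) (u : E × E) :
    fderiv ℝ (fun z' => ((0 : E), s z')) z u = (0, fderiv ℝ s z u) := by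
  rw [(differentiableAt_const (0 : E)).fderiv_prodMk hs]
  simp

namespace IsSprayOn

variable {s : E × E → E} (hs : IsSprayOn U s)
include hs

theorem smooth_connMap : ContDiffOn ℝ ∞ (connMap s) U := by
  have h := contDiffOn_fderiv hs.isOpen hs.smooth
  exact (h.clm_comp contDiffOn_const).const_smul (1 / 2 : ℝ)

theorem smooth_hlift (a : E) : ContDiffOn ℝ ∞ (fun z => hlift s z a) U :=
  contDiffOn_const.prodMk (hs.smooth_connMap.clm_apply contDiffOn_const)

theorem smooth_fderiv_connMap : ContDiffOn ℝ ∞ (fderiv ℝ (connMap s)) U :=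
  contDiffOn_fderiv hs.isOpen hs.smooth_connMap

theorem smooth_curv (a b : E) : ContDiffOn ℝ ∞ (fun z => curv s z a b) U :=
  ((hs.smooth_fderiv_connMap.clm_apply (hs.smooth_hlift a)).clm_apply contDiffOn_const).sub
    ((hs.smooth_fderiv_connMap.clm_apply (hs.smooth_hlift b)).clm_apply contDiffOn_const)

variable {z : E × E} (hz : z ∈ U)
include hz

theorem fderiv_hlift (a : E) (u : E × E) :
    fderiv ℝ (fun z' => hlift s z' a) z u = (0, fderiv ℝ (connMap s) z u a) := by
  have hd := differentiableAt_of_smooth hs.isOpen hs.smooth_connMap hz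
  have : (fun z' => hlift s z' a) = fun z' => (a, connMap s z' a) := rfl
  rw [this, (differentiableAt_const a).fderiv_prodMk (hd.clm_apply (differentiableAt_const a))]
  simp [fderiv_apply_const hd]

theorem fderiv_connMap_apply (u : E × E) (a : E) :
    fderiv ℝ (connMap s) z u a = (1 / 2 : ℝ) • fderiv ℝ (fderiv ℝ s) z u (0, a) := by
  have hd := differentiableAt_of_smooth hs.isOpen hs.smooth_connMap hz
  have hd' := differentiableAt_of_smooth hs.isOpen (contDiffOn_fderiv hs.isOpen hs.smooth) hz
  rw [← fderiv_apply_const hd, ← fderiv_apply_const hd']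
  simp only [connMap_apply]
  rw [fderiv_fun_const_smul (hd'.clm_apply (differentiableAt_const _))]
  rfl

theorem fderiv_connMap_vertical_comm (a b : E) :
    fderiv ℝ (connMap s) z (0, a) b = fderiv ℝ (connMap s) z (0, b) a := by
  rw [hs.fderiv_connMap_apply hz, hs.fderiv_connMap_apply hz,
    fderiv_fderiv_comm hs.isOpen hs.smooth hz]

theorem connMap_self : connMap s z z.2 = s z := by
  have := hs.euler z hz
  rw [connMap_apply, show ((0 : E), z.2) = liouville z from rfl, this, smul_smul]
  norm_num

theorem hlift_self : hlift s z z.2 = (z.2, s z) := by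
  rw [hlift_apply, hs.connMap_self hz]

theorem fderiv_connMap_liouville : fderiv ℝ (connMap s) z (liouville z) = connMap s z := by
  ext a
  rw [hs.fderiv_connMap_apply hz, fderiv_fderiv_comm hs.isOpen hs.smooth hz,
    euler_fderiv hs.isOpen hs.smooth hs.euler hz, connMap_apply]
  simp only [two_smul]
  congr 1
  abel

theorem fderiv_curv (a b : E) (u : E × E) :
    fderiv ℝ (fun z' => curv s z' a b) z u
      = fderiv ℝ (fderiv ℝ (connMap s)) z u (hlift s z a) b
        + fderiv ℝ (connMap s) z (0, fderiv ℝ (connMap s) z u a) b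
        - (fderiv ℝ (fderiv ℝ (connMap s)) z u (hlift s z b) a
          + fderiv ℝ (connMap s) z (0, fderiv ℝ (connMap s) z u b) a) := by
  have hd := differentiableAt_of_smooth hs.isOpen hs.smooth_fderiv_connMap hz
  have hh := fun c => differentiableAt_of_smooth hs.isOpen (hs.smooth_hlift c) hz
  have key : ∀ c d : E, fderiv ℝ (fun z' => fderiv ℝ (connMap s) z' (hlift s z' c) d) z u
      = fderiv ℝ (fderiv ℝ (connMap s)) z u (hlift s z c) d
        + fderiv ℝ (connMap s) z (0, fderiv ℝ (connMap s) z u c) d := by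
    intro c d
    rw [fderiv_apply_const (hd.clm_apply (hh c)), fderiv_apply_field hd (hh c),
      hs.fderiv_hlift hz]
    rfl
  have hd1 := fun c d : E => (hd.clm_apply (hh c)).clm_apply (differentiableAt_const d)
  rw [← key, ← key]
  simp only [curv]
  rw [fderiv_fun_sub (hd1 a b) (hd1 b a)]
  rfl

/-- The vertical Bianchi identity `[J, R] = 0`. -/
theorem bianchi_vertical (a b c : E) :
    fderiv ℝ (fun z' => curv s z' a b) z (0, c) + fderiv ℝ (fun z' => curv s z' b c) z (0, a)
      + fderiv ℝ (fun z' => curv s z' c a) z (0, b) = 0 := by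
  have hd := differentiableAt_of_smooth hs.isOpen hs.smooth_fderiv_connMap hz
  -- `∂²Γ(p)/∂yᵠ` is symmetric in `p` and `q`
  have sym : ∀ (w : E × E) (p q : E), fderiv ℝ (fderiv ℝ (connMap s)) z (0, p) w q
      = fderiv ℝ (fderiv ℝ (connMap s)) z (0, q) w p := by
    intro w p q
    have h1 : ∀ p q : E, fderiv ℝ (fderiv ℝ (connMap s)) z w (0, p) q
        = fderiv ℝ (fun z' => fderiv ℝ (connMap s) z' (0, p) q) z w := by
      intro p q
      rw [fderiv_apply_const (hd.clm_apply (differentiableAt_const _)), fderiv_apply_const hd]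
    rw [fderiv_fderiv_comm hs.isOpen hs.smooth_connMap hz,
      fderiv_fderiv_comm hs.isOpen hs.smooth_connMap hz (0, q), h1, h1,
      fderiv_congr_on hs.isOpen (fun z' hz' => hs.fderiv_connMap_vertical_comm hz' p q) hz]
  have comm := hs.fderiv_connMap_vertical_comm hz
  rw [hs.fderiv_curv hz, hs.fderiv_curv hz, hs.fderiv_curv hz]
  rw [sym _ c b, sym _ a c, sym _ b a, comm c a, comm c b, comm a b]
  abel

theorem fderiv_curv_liouville (a b : E) :
    fderiv ℝ (fun z' => curv s z' a b) z (liouville z) = curv s z a b := by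
  have key : ∀ a b : E, fderiv ℝ (fderiv ℝ (connMap s)) z (liouville z) (hlift s z a) b
      = fderiv ℝ (connMap s) z (hlift s z a) b
        - fderiv ℝ (connMap s) z (0, connMap s z a) b := by
    intro a b
    rw [fderiv_fderiv_comm hs.isOpen hs.smooth_connMap hz,
      euler_fderiv hs.isOpen hs.smooth_connMap (k := 1)
        (fun z' hz' => by rw [hs.fderiv_connMap_liouville hz', one_smul]) hz]
    simp [hlift_apply]
  rw [hs.fderiv_curv hz, key, key, hs.fderiv_connMap_liouville hz, curv]
  abel

theorem fderiv_curv_self (b c : E) :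
    fderiv ℝ (fun z' => curv s z' z'.2 b) z (0, c)
      = fderiv ℝ (fun z' => curv s z' z.2 b) z (0, c) + curv s z c b := by
  have hd := differentiableAt_of_smooth hs.isOpen hs.smooth_fderiv_connMap hz
  have hc := differentiableAt_of_smooth hs.isOpen hs.smooth_connMap hz
  have hh := fun c => differentiableAt_of_smooth hs.isOpen (hs.smooth_hlift c) hz
  have h2 : DifferentiableAt ℝ (fun z' : E × E => z'.2) z := differentiableAt_snd
  have hv : DifferentiableAt ℝ (fun z' => hlift s z' z'.2) z := h2.prodMk (hc.clm_apply h2)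
  have hv' : fderiv ℝ (fun z' => hlift s z' z'.2) z (0, c)
      = hlift s z c + fderiv ℝ (fun z' => hlift s z' z.2) z (0, c) := by
    have : (fun z' => hlift s z' z'.2) = fun z' => (z'.2, connMap s z' z'.2) := rfl
    rw [hs.fderiv_hlift hz, this, h2.fderiv_prodMk (hc.clm_apply h2),
      ContinuousLinearMap.prod_apply, fderiv_apply_field hc h2, fderiv_snd]
    simp [hlift_apply, add_comm]
  have e1 : fderiv ℝ (fun z' => fderiv ℝ (connMap s) z' (hlift s z' z'.2) b) z (0, c)
      = fderiv ℝ (fun z' => fderiv ℝ (connMap s) z' (hlift s z' z.2) b) z (0, c)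
        + fderiv ℝ (connMap s) z (hlift s z c) b := by
    rw [fderiv_apply_const (hd.clm_apply hv), fderiv_apply_const (hd.clm_apply (hh z.2)),
      fderiv_apply_field hd hv, fderiv_apply_field hd (hh z.2), hv', map_add]
    simp only [add_apply]
    abel
  have e2 : fderiv ℝ (fun z' => fderiv ℝ (connMap s) z' (hlift s z' b) z'.2) z (0, c)
      = fderiv ℝ (fun z' => fderiv ℝ (connMap s) z' (hlift s z' b) z.2) z (0, c)
        + fderiv ℝ (connMap s) z (hlift s z b) c := by
    rw [fderiv_apply_field (hd.clm_apply (hh b)) h2, fderiv_apply_const (hd.clm_apply (hh b)),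
      fderiv_snd]
    rfl
  have d1 := (hd.clm_apply hv).clm_apply (differentiableAt_const b)
  have d2 := (hd.clm_apply (hh b)).clm_apply h2
  have d3 := (hd.clm_apply (hh z.2)).clm_apply (differentiableAt_const b)
  have d4 := (hd.clm_apply (hh b)).clm_apply (differentiableAt_const z.2)
  simp only [curv]
  rw [fderiv_fun_sub d1 d2, fderiv_fun_sub d3 d4, sub_apply, sub_apply, e1, e2]
  abel

/-- The curvature is determined by its contraction `Rⁱⱼₖ yʲ` with the fibre coordinate. -/
theorem three_smul_curv (b c : E) :
    (3 : ℝ) • curv s z c b = fderiv ℝ (fun z' => curv s z' z'.2 b) z (0, c)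
      - fderiv ℝ (fun z' => curv s z' z'.2 c) z (0, b) := by
  have h := hs.bianchi_vertical hz z.2 b c
  have h1 := hs.fderiv_curv_liouville hz b c
  have h2 : fderiv ℝ (fun z' => curv s z' c z.2) z (0, b)
      = -fderiv ℝ (fun z' => curv s z' z.2 c) z (0, b) := by
    have : (fun z' => curv s z' c z.2) = fun z' => -curv s z' z.2 c := by
      funext z'; exact curv_swap _ _ _ _
    rw [this, fderiv_fun_neg]; rfl
  rw [liouville] at h1
  rw [h1, h2, curv_swap s z c b] at h
  rw [hs.fderiv_curv_self hz, hs.fderiv_curv_self hz, curv_swap s z c b]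
  have h3 : fderiv ℝ (fun z' => curv s z' z.2 b) z (0, c)
      = curv s z c b + fderiv ℝ (fun z' => curv s z' z.2 c) z (0, b) := by
    rw [← sub_eq_zero]
    refine Eq.trans ?_ h
    abel
  rw [h3, show (3 : ℝ) = 1 + 1 + 1 by norm_num, add_smul, add_smul, one_smul]
  abel

/-- The Bianchi identity `[h, R] = 0`, that is, the Jacobi identity for `δⱼ, δₖ, δₗ`. -/
theorem bianchi_horizontal (a b c : E) :
    (fderiv ℝ (fun z' => curv s z' a b) z (hlift s z c)
        - fderiv ℝ (connMap s) z (0, curv s z c a) b)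
      + (fderiv ℝ (fun z' => curv s z' b c) z (hlift s z a)
        - fderiv ℝ (connMap s) z (0, curv s z a b) c)
      + (fderiv ℝ (fun z' => curv s z' c a) z (hlift s z b)
        - fderiv ℝ (connMap s) z (0, curv s z b c) a) = 0 := by
  have comm := fderiv_fderiv_comm hs.isOpen hs.smooth_connMap hz
  have lin : ∀ p q : E, fderiv ℝ (connMap s) z (0, p - q)
      = fderiv ℝ (connMap s) z (0, p) - fderiv ℝ (connMap s) z (0, q) := by
    intro p q
    rw [← map_sub]; simp
  rw [hs.fderiv_curv hz, hs.fderiv_curv hz, hs.fderiv_curv hz]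
  simp only [curv, lin, sub_apply]
  rw [comm (hlift s z c) (hlift s z a), comm (hlift s z c) (hlift s z b),
    comm (hlift s z a) (hlift s z b)]
  abel

end IsSprayOn

end Spray

/-! ### The geodesic spray of a Finsler metric -/

section Metric

variable {E : Type*} [NormedAddCommGroup E] [NormedSpace ℝ E] {U : Set (E × E)}

/-- `L = F²` for a Finsler metric `F` given in coordinates on the open set `U`: `L` is smooth,
2-homogeneous in the fibre (Euler's identity) and has positive definite fibre Hessian. -/
structure IsFinslerOn (U : Set (E × E)) (L : E × E → ℝ) : Prop where
  isOpen : IsOpen U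
  snd_ne_zero : ∀ z ∈ U, z.2 ≠ 0
  smooth : ContDiffOn ℝ ∞ L U
  euler : ∀ z ∈ U, fderiv ℝ L z (liouville z) = (2 : ℝ) • L z
  posDef : ∀ z ∈ U, ∀ u : E, u ≠ 0 → 0 < fderiv ℝ (fderiv ℝ L) z (0, u) (0, u)

/-- The fibre component `s = -2 G` of the geodesic spray `(y, s)`. -/
def sprayVert (L : E × E → ℝ) (z : E × E) : E := (spray L z).2

theorem extD_dJ_apply {L : E × E → ℝ} (hU : IsOpen U) (hL : ContDiffOn ℝ ∞ L U) {z : E × E}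
    (hz : z ∈ U) (u w : E × E) :
    extD (dJ L) z u w
      = fderiv ℝ (fderiv ℝ L) z u (0, w.1) - fderiv ℝ (fderiv ℝ L) z w (0, u.1) := by
  have hd := differentiableAt_of_smooth hU (contDiffOn_fderiv hU hL) hz
  have key : ∀ u w : E × E, fderiv ℝ (dJ L) z u w = fderiv ℝ (fderiv ℝ L) z u (0, w.1) := by
    intro u w
    have hJ : DifferentiableAt ℝ (dJ L) z := hd.clm_comp (differentiableAt_const _)
    rw [← fderiv_apply_const hJ, ← fderiv_apply_const hd]
    rfl
  simp [extD, key]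

namespace IsFinslerOn

variable {L : E × E → ℝ} (hL : IsFinslerOn U L)
include hL

variable {z : E × E} (hz : z ∈ U)
include hz

theorem hess_liouville (u : E × E) :
    fderiv ℝ (fderiv ℝ L) z u (liouville z) = 2 * fderiv ℝ L z u - fderiv ℝ L z (0, u.2) :=
  euler_fderiv hL.isOpen hL.smooth hL.euler hz u

theorem hess_liouville_vert (b : E) :
    fderiv ℝ (fderiv ℝ L) z (0, b) (0, z.2) = fderiv ℝ L z (0, b) := by
  have := hL.hess_liouville hz (0, b)
  rw [liouville] at this
  rw [this]; ring

theorem fderiv_vert_self : fderiv ℝ L z (0, z.2) = 2 * L z := hL.euler z hz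

theorem pos : 0 < L z := by
  have h := hL.posDef z hz z.2 (hL.snd_ne_zero z hz)
  rw [hL.hess_liouville_vert hz, hL.fderiv_vert_self hz] at h
  linarith

theorem hess_comm (u w : E × E) :
    fderiv ℝ (fderiv ℝ L) z u w = fderiv ℝ (fderiv ℝ L) z w u :=
  fderiv_fderiv_comm hL.isOpen hL.smooth hz u w

theorem eq_zero_of_hess {a : E} (h : ∀ w : E, fderiv ℝ (fderiv ℝ L) z (0, a) (0, w) = 0) :
    a = 0 := by
  by_contra ha
  exact (hL.posDef z hz a ha).ne' (h a)

theorem injective_extD : Function.Injective (extD (dJ L) z) := by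
  rw [injective_iff_map_eq_zero]
  intro u hu
  have h : ∀ w : E × E, fderiv ℝ (fderiv ℝ L) z u (0, w.1)
      - fderiv ℝ (fderiv ℝ L) z w (0, u.1) = 0 := by
    intro w
    rw [← extD_dJ_apply hL.isOpen hL.smooth hz, hu]; rfl
  have h1 : u.1 = 0 := hL.eq_zero_of_hess hz fun w => by
    have := h (0, w)
    simp only [Prod.mk_zero_zero, map_zero, zero_sub, neg_eq_zero] at this
    rw [hL.hess_comm hz, this]
  have h2 : u.2 = 0 := hL.eq_zero_of_hess hz fun w => by
    have := h (w, 0)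
    simp only [h1, Prod.mk_zero_zero, map_zero, sub_zero] at this
    rw [← this, ← h1]
  exact Prod.ext h1 h2

theorem hess_sub_sq_pos {X : E} (hX : LinearIndependent ℝ ![z.2, X]) :
    0 < 2 * L z * fderiv ℝ (fderiv ℝ L) z (0, X) (0, X) - fderiv ℝ L z (0, X) ^ 2 := by
  have hpos := hL.pos hz
  have hv : (2 * L z) • X - fderiv ℝ L z (0, X) • z.2 ≠ 0 := by
    intro h
    have := LinearIndependent.pair_iff.1 hX (-fderiv ℝ L z (0, X)) (2 * L z)
      (by rw [neg_smul, add_comm, ← sub_eq_add_neg, h])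
    linarith [this.2]
  -- `g (v, v) = 2 L (2 L g (X, X) - L_X²)` for `v = 2 L X - L_X y`
  have h := hL.posDef z hz _ hv
  have e : ((0 : E), (2 * L z) • X - fderiv ℝ L z (0, X) • z.2)
      = (2 * L z) • (0, X) - fderiv ℝ L z (0, X) • (0, z.2) := by simp
  rw [e] at h
  simp only [map_sub, map_smul, sub_apply, smul_apply, smul_eq_mul] at h
  rw [hL.hess_comm hz (0, z.2), hL.hess_liouville_vert hz, hL.hess_liouville_vert hz,
    hL.fderiv_vert_self hz] at h
  have h2 : 0 < (2 * L z) * (2 * L z * fderiv ℝ (fderiv ℝ L) z (0, X) (0, X)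
      - fderiv ℝ L z (0, X) ^ 2) := by
    refine h.trans_eq ?_
    ring
  exact pos_of_mul_pos_right h2 (by positivity)

theorem differentiableAt_vert (a : E) :
    DifferentiableAt ℝ (fun z' => fderiv ℝ L z' (0, a)) z :=
  (differentiableAt_of_smooth hL.isOpen (contDiffOn_fderiv hL.isOpen hL.smooth) hz).clm_apply
    (differentiableAt_const _)

theorem fderiv_vert (a : E) (u : E × E) :
    fderiv ℝ (fun z' => fderiv ℝ L z' (0, a)) z u = fderiv ℝ (fderiv ℝ L) z u (0, a) :=
  fderiv_apply_const
    (differentiableAt_of_smooth hL.isOpen (contDiffOn_fderiv hL.isOpen hL.smooth) hz) _ _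

section FiniteDimensional

variable [FiniteDimensional ℝ E]

theorem exists_equiv : ∃ e : (E × E) ≃L[ℝ] (E × E →L[ℝ] ℝ),
    (e : E × E →L[ℝ] (E × E →L[ℝ] ℝ)) = extD (dJ L) z := by
  have hdim : Module.finrank ℝ (E × E) = Module.finrank ℝ (E × E →L[ℝ] ℝ) := by
    rw [← (LinearMap.toContinuousLinearMap (𝕜 := ℝ) (E := E × E) (F' := ℝ)).finrank_eq]
    exact (Subspace.dual_finrank_eq (K := ℝ) (V := E × E)).symm
  refine ⟨((extD (dJ L) z).toLinearMap.linearEquivOfInjective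
    (hL.injective_extD hz) hdim).toContinuousLinearEquiv, ?_⟩
  exact ContinuousLinearMap.ext fun u => rfl

theorem spray_spec : extD (dJ L) z (spray L z) = -fderiv ℝ L z := by
  obtain ⟨e, he⟩ := hL.exists_equiv hz
  rw [spray, ← he, ContinuousLinearMap.inverse_equiv]
  exact e.apply_symm_apply _

theorem spray_unique {u : E × E} (hu : extD (dJ L) z u = -fderiv ℝ L z) : u = spray L z :=
  hL.injective_extD hz (hu.trans (hL.spray_spec hz).symm)

theorem contDiffAt_spray : ContDiffAt ℝ ∞ (spray L) z := by
  obtain ⟨e, he⟩ := hL.exists_equiv hz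
  have h1 := contDiffOn_fderiv hL.isOpen hL.smooth
  have h2 : ContDiffOn ℝ ∞ (dJ L) U := h1.clm_comp contDiffOn_const
  have h3 := contDiffOn_fderiv hL.isOpen h2
  have h4 : ContDiffOn ℝ ∞ (extD (dJ L)) U := by
    exact h3.sub (contDiff_flip.comp_contDiffOn h3)
  have hU := hL.isOpen.mem_nhds hz
  have h5 : ContDiffAt ℝ ∞ (fun z' => (extD (dJ L) z').inverse) z := by
    refine ContDiffAt.comp (g := ContinuousLinearMap.inverse) z ?_ (h4.contDiffAt hU)
    rw [← he]
    exact contDiffAt_map_inverse e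
  exact h5.clm_apply (h1.contDiffAt hU).neg

theorem spray_fst : (spray L z).1 = z.2 := by
  rw [← sub_eq_zero]
  refine hL.eq_zero_of_hess hz fun w => ?_
  have h := DFunLike.congr_fun (hL.spray_spec hz) (0, w)
  rw [extD_dJ_apply hL.isOpen hL.smooth hz] at h
  simp only [Prod.mk_zero_zero, map_zero, zero_sub, neg_apply, neg_inj] at h
  have e : ((0 : E), (spray L z).1 - z.2) = (0, (spray L z).1) - (0, z.2) := by simp
  rw [e, map_sub, sub_apply, hL.hess_comm hz, h, hL.hess_comm hz, hL.hess_liouville_vert hz,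
    sub_self]

theorem spray_eq : spray L z = (z.2, sprayVert L z) :=
  Prod.ext (hL.spray_fst hz) rfl

/-- The Euler–Lagrange equations. -/
theorem euler_lagrange (w : E) :
    fderiv ℝ (fderiv ℝ L) z (spray L z) (0, w) = fderiv ℝ L z (w, 0) := by
  have h := DFunLike.congr_fun (hL.spray_spec hz) (w, 0)
  rw [extD_dJ_apply hL.isOpen hL.smooth hz, hL.spray_fst hz] at h
  have h1 := hL.hess_liouville hz (w, 0)
  simp only [liouville, Prod.mk_zero_zero, map_zero, sub_zero, neg_apply] at h h1
  rw [h1] at h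
  linarith

theorem fderiv_spray_self : fderiv ℝ L z (spray L z) = 0 := by
  have h := DFunLike.congr_fun (hL.spray_spec hz) (spray L z)
  rw [extD_dJ_apply hL.isOpen hL.smooth hz, sub_self, neg_apply] at h
  linarith

omit hz in
theorem smooth_sprayVert : ContDiffOn ℝ ∞ (sprayVert L) U := fun _ hz =>
  (contDiff_snd.contDiffAt.comp _ (hL.contDiffAt_spray hz)).contDiffWithinAt

theorem fderiv_spray (u : E × E) :
    fderiv ℝ (spray L) z u = (u.2, fderiv ℝ (sprayVert L) z u) := by
  have hd := differentiableAt_of_smooth hL.isOpen hL.smooth_sprayVert hz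
  rw [fderiv_congr_on hL.isOpen (fun z' hz' => hL.spray_eq hz') hz,
    differentiableAt_snd.fderiv_prodMk hd]
  simp [fderiv_snd]

omit hz in
/-- The fibre component of the geodesic spray is 2-homogeneous. -/
theorem isSprayOn : IsSprayOn U (sprayVert L) where
  isOpen := hL.isOpen
  smooth := hL.smooth_sprayVert
  euler := by
    intro z hz
    rw [← sub_eq_zero]
    refine hL.eq_zero_of_hess hz fun w => ?_
    have hL1 := contDiffOn_fderiv hL.isOpen hL.smooth
    have hd1 := differentiableAt_of_smooth hL.isOpen hL1 hz
    have hS := (hL.contDiffAt_spray hz).differentiableAt (by simp)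
    -- `M = ∂L/∂y (w)` is 1-homogeneous
    set M : E × E → ℝ := fun z' => fderiv ℝ L z' (0, w) with hM
    have hMs : ContDiffOn ℝ ∞ M U := hL1.clm_apply contDiffOn_const
    have hDM : ∀ z' ∈ U, ∀ u, fderiv ℝ M z' u = fderiv ℝ (fderiv ℝ L) z' u (0, w) :=
      fun z' hz' u => fderiv_apply_const (differentiableAt_of_smooth hL.isOpen hL1 hz') _ _
    have hME : ∀ z' ∈ U, fderiv ℝ M z' (liouville z') = (1 : ℝ) • M z' := by
      intro z' hz'
      rw [hDM z' hz', hL.hess_comm hz', liouville, hL.hess_liouville_vert hz', one_smul]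
    have h1 := euler_fderiv hL.isOpen hMs hME hz (spray L z)
    -- the Euler–Lagrange equation for `w`, differentiated along `𝒞`
    have h2 := fderiv_congr_on hL.isOpen
      (fun z' hz' => (hDM z' hz' _).trans (hL.euler_lagrange hz' w)) hz
    have h3 := DFunLike.congr_fun h2 (liouville z)
    have h5 : fderiv ℝ (fun z' => fderiv ℝ L z' (w, 0)) z (liouville z)
        = 2 * fderiv ℝ L z (w, 0) - fderiv ℝ L z (0, 0) := by
      rw [fderiv_apply_const hd1, hL.hess_comm hz, hL.hess_liouville hz]
    rw [h5, fderiv_apply_field (differentiableAt_of_smooth hL.isOpen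
      (contDiffOn_fderiv hL.isOpen hMs) hz) hS, fderiv_fderiv_comm hL.isOpen hMs hz, h1,
      hL.fderiv_spray hz] at h3
    have h4 := (hDM z hz _).trans (hL.euler_lagrange hz w)
    rw [hL.spray_eq hz] at h3 h4
    rw [← hDM z hz]
    simp only [liouville, Prod.mk_zero_zero, map_zero, sub_zero, ← h4] at h3 ⊢
    have e1 : (z.2, sprayVert L z) = (z.2, (0 : E)) + (0, sprayVert L z) := by simp
    have e2 : ∀ v : E, (z.2, v) = (z.2, (0 : E)) + (0, v) := by simp
    have e3 : ∀ v v' : E, ((0 : E), v - (2 : ℝ) • v') = (0, v) - (2 : ℝ) • (0, v') := by simp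
    rw [e2 (sprayVert L z), e2 (fderiv ℝ (sprayVert L) z (0, z.2))] at h3
    rw [e3]
    simp only [map_add, map_sub, map_smul, smul_eq_mul] at h3 ⊢
    linarith

/-! ### The horizontal derivative of a Finsler metric -/

/-- `δₐ L = 0`: the metric is horizontally constant. -/
theorem fderiv_hlift_eq_zero (a : E) : fderiv ℝ L z (hlift (sprayVert L) z a) = 0 := by
  have hd1 := differentiableAt_of_smooth hL.isOpen (contDiffOn_fderiv hL.isOpen hL.smooth) hz
  have hS := (hL.contDiffAt_spray hz).differentiableAt (by simp)
  have h := fderiv_congr_on hL.isOpen (fun z' hz' => hL.fderiv_spray_self hz') hz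
  have h1 := DFunLike.congr_fun h (0, a)
  rw [fderiv_apply_field hd1 hS, hL.hess_comm hz, hL.euler_lagrange hz, hL.fderiv_spray hz] at h1
  have e : hlift (sprayVert L) z a
      = (1 / 2 : ℝ) • ((a, 0) + (a, fderiv ℝ (sprayVert L) z (0, a))) := by
    rw [hlift_apply, connMap_apply]
    ext
    · simp [← two_smul ℝ a, smul_smul]
    · simp
  rw [e, map_smul, map_add, h1]
  simp

/-- `δₐ L_b = δ_b Lₐ` for the fibre derivatives of `L`. -/
theorem hess_hlift_comm (a b : E) :
    fderiv ℝ (fderiv ℝ L) z (hlift (sprayVert L) z a) (0, b)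
      = fderiv ℝ (fderiv ℝ L) z (hlift (sprayVert L) z b) (0, a) := by
  have hs := hL.isSprayOn
  have hd1 := differentiableAt_of_smooth hL.isOpen (contDiffOn_fderiv hL.isOpen hL.smooth) hz
  have key : ∀ a b : E, fderiv ℝ (fderiv ℝ L) z (hlift (sprayVert L) z a) (0, b)
      = -fderiv ℝ L z (0, fderiv ℝ (connMap (sprayVert L)) z (0, b) a) := by
    intro a b
    have h := fderiv_congr_on hL.isOpen (fun z' hz' => hL.fderiv_hlift_eq_zero hz' a) hz
    have h1 := DFunLike.congr_fun h (0, b)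
    rw [fderiv_apply_field hd1 (differentiableAt_of_smooth hL.isOpen (hs.smooth_hlift a) hz),
      hs.fderiv_hlift hz, hL.hess_comm hz, fderiv_fun_const] at h1
    exact eq_neg_of_add_eq_zero_left h1
  rw [key, key, hs.fderiv_connMap_vertical_comm hz]

/-- The curvature preserves the metric: `R(δₐ, δ_b) L = 0`. -/
theorem fderiv_curv_eq_zero (a b : E) : fderiv ℝ L z (0, curv (sprayVert L) z a b) = 0 := by
  have hs := hL.isSprayOn
  have hd1 := differentiableAt_of_smooth hL.isOpen (contDiffOn_fderiv hL.isOpen hL.smooth) hz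
  have key : ∀ a b : E, fderiv ℝ L z
        (0, fderiv ℝ (connMap (sprayVert L)) z (hlift (sprayVert L) z a) b)
      = -fderiv ℝ (fderiv ℝ L) z (hlift (sprayVert L) z a) (hlift (sprayVert L) z b) := by
    intro a b
    have h := fderiv_congr_on hL.isOpen (fun z' hz' => hL.fderiv_hlift_eq_zero hz' b) hz
    have h1 := DFunLike.congr_fun h (hlift (sprayVert L) z a)
    rw [fderiv_apply_field hd1 (differentiableAt_of_smooth hL.isOpen (hs.smooth_hlift b) hz),
      hs.fderiv_hlift hz, fderiv_fun_const] at h1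
    exact eq_neg_of_add_eq_zero_right h1
  have e : ((0 : E), curv (sprayVert L) z a b)
      = (0, fderiv ℝ (connMap (sprayVert L)) z (hlift (sprayVert L) z a) b)
        - (0, fderiv ℝ (connMap (sprayVert L)) z (hlift (sprayVert L) z b) a) := by
    simp [curv]
  rw [e, map_sub, key, key, hL.hess_comm hz]
  ring

/-- The Jacobi endomorphism `b ↦ R(y, b)` is self-adjoint for the metric tensor. -/
theorem hess_curv_comm (b c : E) :
    fderiv ℝ (fderiv ℝ L) z (0, c) (0, curv (sprayVert L) z z.2 b)
      = fderiv ℝ (fderiv ℝ L) z (0, b) (0, curv (sprayVert L) z z.2 c) := by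
  have hs := hL.isSprayOn
  have hd1 := differentiableAt_of_smooth hL.isOpen (contDiffOn_fderiv hL.isOpen hL.smooth) hz
  have key : ∀ a b c : E, fderiv ℝ (fderiv ℝ L) z (0, c) (0, curv (sprayVert L) z a b)
      = -fderiv ℝ L z (0, fderiv ℝ (fun z' => curv (sprayVert L) z' a b) z (0, c)) := by
    intro a b c
    have hc := differentiableAt_of_smooth hL.isOpen (hs.smooth_curv a b) hz
    have h := fderiv_congr_on hL.isOpen (fun z' hz' => hL.fderiv_curv_eq_zero hz' a b) hz
    have h1 := DFunLike.congr_fun h (0, c)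
    rw [fderiv_apply_field hd1 ((differentiableAt_const _).prodMk hc), fderiv_prod_zero hc,
      fderiv_fun_const] at h1
    exact eq_neg_of_add_eq_zero_left h1
  have hcyc : fderiv ℝ (fderiv ℝ L) z (0, c) (0, curv (sprayVert L) z z.2 b)
      + fderiv ℝ (fderiv ℝ L) z (0, z.2) (0, curv (sprayVert L) z b c)
      + fderiv ℝ (fderiv ℝ L) z (0, b) (0, curv (sprayVert L) z c z.2) = 0 := by
    rw [key, key, key, ← neg_add, ← neg_add, ← map_add, ← map_add, Prod.mk_add_mk,
      Prod.mk_add_mk, hs.bianchi_vertical hz]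
    simp only [add_zero, Prod.mk_zero_zero, map_zero, neg_zero]
  rw [hL.hess_comm hz (0, z.2), hL.hess_liouville_vert hz, hL.fderiv_curv_eq_zero hz,
    curv_swap _ z z.2 c] at hcyc
  have e : ((0 : E), -curv (sprayVert L) z z.2 c) = -(0, curv (sprayVert L) z z.2 c) := by simp
  rw [e, map_neg] at hcyc
  linarith

end FiniteDimensional

end IsFinslerOn

end Metric

/-! ### Linear algebra in dimension greater than two -/

section LinearAlgebra

variable {E : Type*} [NormedAddCommGroup E] [NormedSpace ℝ E]

theorem exists_notMem_span_pair (hn : 2 < Module.finrank ℝ E) (a c : E) :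
    ∃ b : E, b ∉ Submodule.span ℝ {a, c} := by
  by_contra! h
  have htop : Submodule.span ℝ ({a, c} : Set E) = ⊤ := Submodule.eq_top_iff'.2 h
  classical
  have h1 := finrank_span_finset_le_card (R := ℝ) ({a, c} : Finset E)
  have h2 : (({a, c} : Finset E) : Set E) = {a, c} := by simp
  rw [Set.finrank, h2, htop, finrank_top] at h1
  have h3 := Finset.card_le_two (a := a) (b := c)
  omega

theorem eq_zero_of_smul_mem {p : Submodule ℝ E} {b : E} (hb : b ∉ p) {t : ℝ} (h : t • b ∈ p) :
    t = 0 := by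
  by_contra ht
  exact hb ((p.smul_mem_iff ht).1 h)

end LinearAlgebra

/-! ### Horizontal projector, curvature and flag curvature -/

section Flag

variable {E : Type*} [NormedAddCommGroup E] [NormedSpace ℝ E] [FiniteDimensional ℝ E]
  {U : Set (E × E)}

namespace IsFinslerOn

variable {L : E × E → ℝ} (hL : IsFinslerOn U L)
include hL

variable {z : E × E} (hz : z ∈ U)
include hz

theorem horProj_spray (w : E × E) : horProj (spray L) z w = hlift (sprayVert L) z w.1 := by
  simp only [horProj, smul_apply, sub_apply, ContinuousLinearMap.comp_apply, hL.fderiv_spray hz]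
  rw [hlift_apply, connMap_apply]
  ext
  · simp [vertEnd, ← two_smul ℝ w.1, smul_smul]
  · simp [vertEnd]

theorem fderiv_horProj_spray (w u : E × E) :
    fderiv ℝ (fun z' => horProj (spray L) z' w) z u
      = (0, fderiv ℝ (connMap (sprayVert L)) z u w.1) := by
  rw [fderiv_congr_on hL.isOpen (fun z' hz' => hL.horProj_spray hz' w) hz,
    hL.isSprayOn.fderiv_hlift hz]

theorem curvature_horProj_spray (u w : E × E) :
    curvature (horProj (spray L)) z u w = (0, curv (sprayVert L) z u.1 w.1) := by
  simp only [curvature, halfBracket, VectorField.lieBracket, hL.fderiv_horProj_spray hz,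
    hL.horProj_spray hz]
  simp [curv]

theorem flagCurvature_eq_iff {X : E} (hX : LinearIndependent ℝ ![z.2, X]) (κ : ℝ) :
    flagCurvature L z X = κ ↔
      2 * fderiv ℝ (fderiv ℝ L) z (0, X) (0, curv (sprayVert L) z z.2 X)
        = κ * (2 * L z * fderiv ℝ (fderiv ℝ L) z (0, X) (0, X) - fderiv ℝ L z (0, X) ^ 2) := by
  have hq := hL.hess_sub_sq_pos hz hX
  have hden : metricTensor L z z.2 z.2 * metricTensor L z X X - metricTensor L z z.2 X ^ 2
      = (1 / 4) * (2 * L z * fderiv ℝ (fderiv ℝ L) z (0, X) (0, X)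
        - fderiv ℝ L z (0, X) ^ 2) := by
    rw [metricTensor, metricTensor, metricTensor, hL.hess_comm hz (0, z.2) (0, X),
      hL.hess_liouville_vert hz, hL.hess_liouville_vert hz, hL.fderiv_vert_self hz]
    ring
  rw [flagCurvature, hden, hL.curvature_horProj_spray hz, hL.spray_fst hz,
    div_eq_iff (by positivity), metricTensor]
  constructor <;> intro h <;> linarith

/-- The flag curvature at `z` is `κ` on all flags if and only if `R(y, b) = κ (F² b - g(y, b) y)`
for all `b`. -/
theorem forall_flagCurvature_eq_iff (κ : ℝ) :
    (∀ X : E, LinearIndependent ℝ ![z.2, X] → flagCurvature L z X = κ) ↔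
      ∀ b : E, curv (sprayVert L) z z.2 b
        = κ • (L z • b - (1 / 2 * fderiv ℝ L z (0, b)) • z.2) := by
  have hvert : ∀ u v : E, ((0 : E), u - v) = (0, u) - (0, v) := by simp
  have hsmul : ∀ (c : ℝ) (u : E), ((0 : E), c • u) = c • (0, u) := by simp
  have hadd : ∀ u v : E, ((0 : E), u + v) = (0, u) + (0, v) := by simp
  have hyl : ∀ b : E, fderiv ℝ (fderiv ℝ L) z (0, z.2) (0, b) = fderiv ℝ L z (0, b) := by
    intro b
    rw [hL.hess_comm hz, hL.hess_liouville_vert hz]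
  constructor
  · intro h
    have hquad : ∀ X : E, 2 * fderiv ℝ (fderiv ℝ L) z (0, X) (0, curv (sprayVert L) z z.2 X)
        = κ * (2 * L z * fderiv ℝ (fderiv ℝ L) z (0, X) (0, X) - fderiv ℝ L z (0, X) ^ 2) := by
      intro X
      by_cases hX : LinearIndependent ℝ ![z.2, X]
      · exact (hL.flagCurvature_eq_iff hz hX κ).1 (h X hX)
      · rw [LinearIndependent.pair_iff' (hL.snd_ne_zero z hz)] at hX
        push Not at hX
        obtain ⟨c, rfl⟩ := hX
        have h0 : curv (sprayVert L) z z.2 (c • z.2) = 0 := by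
          rw [curv_swap, curv_smul_left]
          simp [curv]
        rw [h0, hsmul]
        simp only [map_smul, smul_apply, smul_eq_mul, hyl, hL.fderiv_vert_self hz,
          Prod.mk_zero_zero, map_zero]
        ring
    have hcurv_add : ∀ X Y : E, curv (sprayVert L) z z.2 (X + Y)
        = curv (sprayVert L) z z.2 X + curv (sprayVert L) z z.2 Y := by
      intro X Y
      rw [curv_swap, curv_add_left, curv_swap _ _ z.2 X, curv_swap _ _ z.2 Y]
      abel
    intro b
    rw [← sub_eq_zero]
    refine hL.eq_zero_of_hess hz fun X => ?_
    have hp := hquad (X + b)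
    rw [hcurv_add, hadd, hadd] at hp
    simp only [map_add, add_apply] at hp
    have hX := hquad X
    have hb := hquad b
    have hsym := hL.hess_curv_comm hz b X
    have hsym' := hL.hess_comm hz (0, X) (0, b)
    rw [hL.hess_comm hz, hvert, hsmul, hvert, hsmul, hsmul]
    simp only [map_sub, map_smul, smul_eq_mul]
    rw [hL.hess_liouville_vert hz X]
    linear_combination (1 / 4) * hp - (1 / 4) * hX - (1 / 4) * hb + (1 / 2) * hsym
      - (κ * L z / 2) * hsym'
  · intro h X hX
    rw [hL.flagCurvature_eq_iff hz hX, h, hsmul, hvert, hsmul, hsmul]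
    simp only [map_sub, map_smul, smul_eq_mul]
    rw [hL.hess_liouville_vert hz X]
    ring

omit hz in
/-- For constant flag curvature the whole curvature tensor is
`R(a, b) = κ (g(y, a) b - g(y, b) a)`. -/
theorem curv_eq_of_flagCurvature_eq {κ : ℝ}
    (h : ∀ z ∈ U, ∀ X : E, LinearIndependent ℝ ![z.2, X] → flagCurvature L z X = κ)
    {z : E × E} (hz : z ∈ U) (a b : E) :
    curv (sprayVert L) z a b
      = (κ / 2 * fderiv ℝ L z (0, a)) • b - (κ / 2 * fderiv ℝ L z (0, b)) • a := by
  have key : ∀ c b : E, fderiv ℝ (fun z' => curv (sprayVert L) z' z'.2 b) z (0, c)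
      = κ • (fderiv ℝ L z (0, c) • b
        - ((1 / 2 * fderiv ℝ (fderiv ℝ L) z (0, c) (0, b)) • z.2
          + (1 / 2 * fderiv ℝ L z (0, b)) • c)) := by
    intro c b
    rw [fderiv_congr_on hL.isOpen
      (fun z' hz' => (hL.forall_flagCurvature_eq_iff hz' κ).1 (h z' hz') b) hz]
    have d1 := (differentiableAt_of_smooth hL.isOpen hL.smooth hz).hasFDerivAt
    have d2 := (hL.differentiableAt_vert hz b).hasFDerivAt
    have d3 : HasFDerivAt (fun z' : E × E => z'.2) (ContinuousLinearMap.snd ℝ E E) z :=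
      hasFDerivAt_snd
    have d := ((d1.smul_const b).sub ((d2.const_mul (1 / 2)).smul d3)).const_smul κ
    have e := DFunLike.congr_fun d.fderiv (0, c)
    refine Eq.trans (Eq.trans ?_ e) ?_
    · rfl
    · simp [hL.fderiv_vert hz, add_comm]
  have h3 := hL.isSprayOn.three_smul_curv hz b a
  rw [key, key, hL.hess_comm hz (0, b) (0, a)] at h3
  have h4 : curv (sprayVert L) z a b = (1 / 3 : ℝ) • ((3 : ℝ) • curv (sprayVert L) z a b) := by
    rw [smul_smul]; norm_num
  rw [h4, h3]
  module

omit hz in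
/-- Schur's lemma: an isotropic curvature whose factor `K` is constant along the fibres has `K`
locally constant, provided the dimension is at least three. -/
theorem fderiv_eq_zero_of_isotropic (hn : 2 < Module.finrank ℝ E) {K : E × E → ℝ}
    (hK : ContDiffOn ℝ ∞ K U) (hKv : ∀ z ∈ U, ∀ a : E, fderiv ℝ K z (0, a) = 0)
    (hcurv : ∀ z ∈ U, ∀ a b : E, curv (sprayVert L) z a b
      = (K z / 2 * fderiv ℝ L z (0, a)) • b - (K z / 2 * fderiv ℝ L z (0, b)) • a)
    {z : E × E} (hz : z ∈ U) : fderiv ℝ K z = 0 := by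
  have hs := hL.isSprayOn
  have hU := hL.isOpen
  set m : E → E × E → ℝ := fun a z' => K z' / 2 * fderiv ℝ L z' (0, a) with hm
  have hmd : ∀ z ∈ U, ∀ a, DifferentiableAt ℝ (m a) z := by
    intro z hz a
    simp only [hm, div_eq_mul_inv]
    exact ((differentiableAt_of_smooth hU hK hz).mul_const _).mul (hL.differentiableAt_vert hz a)
  have hDm : ∀ z ∈ U, ∀ a u, fderiv ℝ (m a) z u
      = 1 / 2 * (fderiv ℝ K z u * fderiv ℝ L z (0, a))
        + K z / 2 * fderiv ℝ (fderiv ℝ L) z u (0, a) := by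
    intro z hz a u
    have d1 := (differentiableAt_of_smooth hU hK hz).hasFDerivAt
    have d2 := (hL.differentiableAt_vert hz a).hasFDerivAt
    have d := (d1.mul_const (1 / 2 : ℝ)).mul d2
    have e := DFunLike.congr_fun d.fderiv u
    refine Eq.trans (Eq.trans ?_ e) ?_
    · simp only [hm, div_eq_mul_one_div (K _) 2]; rfl
    · simp [hL.fderiv_vert hz]; ring
  have hDcurv : ∀ z ∈ U, ∀ (a b : E) (u : E × E),
      fderiv ℝ (fun z' => curv (sprayVert L) z' a b) z u
        = fderiv ℝ (m a) z u • b - fderiv ℝ (m b) z u • a := by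
    intro z hz a b u
    rw [fderiv_congr_on hU (fun z' hz' => hcurv z' hz' a b) hz]
    have d := ((hmd z hz a).hasFDerivAt.smul_const b).sub
      ((hmd z hz b).hasFDerivAt.smul_const a)
    exact (DFunLike.congr_fun d.fderiv u).trans (by simp)
  have hh : ∀ z ∈ U, ∀ c, fderiv ℝ K z (hlift (sprayVert L) z c) = fderiv ℝ K z (c, 0) := by
    intro z hz c
    have : hlift (sprayVert L) z c = (c, 0) + (0, connMap (sprayVert L) z c) := by
      simp [hlift_apply]
    rw [this, map_add, hKv z hz, add_zero]
  -- the Bianchi identity, tested on a third direction `b` independent of `a` and `c`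
  have hsym : ∀ z ∈ U, ∀ a c : E, fderiv ℝ K z (c, 0) * fderiv ℝ L z (0, a)
      = fderiv ℝ K z (a, 0) * fderiv ℝ L z (0, c) := by
    intro z hz a c
    obtain ⟨b, hb⟩ := exists_notMem_span_pair hn a c
    have hB := hs.bianchi_horizontal hz a b c
    rw [hDcurv z hz, hDcurv z hz, hDcurv z hz, hcurv z hz, hcurv z hz, hcurv z hz] at hB
    have lin : ∀ (p q : ℝ) (u v w : E),
        fderiv ℝ (connMap (sprayVert L)) z (0, p • u - q • v) w
          = p • fderiv ℝ (connMap (sprayVert L)) z (0, u) w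
            - q • fderiv ℝ (connMap (sprayVert L)) z (0, v) w := by
      intro p q u v w
      have : ((0 : E), p • u - q • v) = p • (0, u) - q • (0, v) := by simp
      rw [this]
      simp only [map_sub, map_smul, sub_apply, smul_apply]
    have comm := hs.fderiv_connMap_vertical_comm hz
    rw [lin, lin, lin, comm b a, comm c a, comm c b] at hB
    have h0 : fderiv ℝ (m a) z (hlift (sprayVert L) z c)
        - fderiv ℝ (m c) z (hlift (sprayVert L) z a) = 0 := by
      refine eq_zero_of_smul_mem hb (Submodule.mem_span_pair.2
        ⟨fderiv ℝ (m b) z (hlift (sprayVert L) z c) - fderiv ℝ (m c) z (hlift (sprayVert L) z b),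
          fderiv ℝ (m a) z (hlift (sprayVert L) z b)
            - fderiv ℝ (m b) z (hlift (sprayVert L) z a), ?_⟩)
      rw [← sub_eq_zero, ← neg_eq_zero, ← hB]
      module
    rw [hDm z hz, hDm z hz, hL.hess_hlift_comm hz c a, hh z hz, hh z hz] at h0
    linarith
  -- differentiate once more along the fibre
  have hKd := differentiableAt_of_smooth hU (contDiffOn_fderiv hU hK) hz
  have hDk : ∀ c b : E, fderiv ℝ (fun z' => fderiv ℝ K z' (c, 0)) z (0, b) = 0 := by
    intro c b
    rw [fderiv_apply_const hKd, fderiv_fderiv_comm hU hK hz, ← fderiv_apply_const hKd,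
      fderiv_congr_on hU (fun z' hz' => hKv z' hz' b) hz]
    simp
  have hvec : ∀ a c : E, fderiv ℝ K z (c, 0) • a - fderiv ℝ K z (a, 0) • c = 0 := by
    intro a c
    refine hL.eq_zero_of_hess hz fun b => ?_
    have h := DFunLike.congr_fun (fderiv_congr_on hU (fun z' hz' => hsym z' hz' a c) hz) (0, b)
    have d := fun a => (hKd.clm_apply (differentiableAt_const (a, (0 : E))))
    rw [fderiv_fun_mul (d c) (hL.differentiableAt_vert hz a),
      fderiv_fun_mul (d a) (hL.differentiableAt_vert hz c)] at h
    simp only [add_apply, smul_apply, hDk, hL.fderiv_vert hz, smul_eq_mul, mul_zero,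
      add_zero] at h
    have e : ((0 : E), fderiv ℝ K z (c, 0) • a - fderiv ℝ K z (a, 0) • c)
        = fderiv ℝ K z (c, 0) • (0, a) - fderiv ℝ K z (a, 0) • (0, c) := by simp
    rw [e, hL.hess_comm hz, map_sub, map_smul, map_smul, smul_eq_mul, smul_eq_mul, h, sub_self]
  have hc : ∀ c : E, fderiv ℝ K z (c, 0) = 0 := by
    intro c
    obtain ⟨b, hb⟩ := exists_notMem_span_pair hn c c
    refine eq_zero_of_smul_mem hb ?_
    rw [sub_eq_zero.1 (hvec b c)]
    exact Submodule.smul_mem _ _ (Submodule.subset_span (by simp))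
  ext u
  · simpa using hc u
  · simpa using hKv z hz u

end IsFinslerOn

end Flag

/-! ### Projective changes of sprays -/

section Projective

variable {E : Type*} [NormedAddCommGroup E] [NormedSpace ℝ E] {U : Set (E × E)}

/-- The components `δₐ P_b - δ_b Pₐ` of `d_h d_J P`, for the spray `(y, s)`. -/
def hamelForm (s : E × E → E) (P : E × E → ℝ) (z : E × E) (a b : E) : ℝ :=
  fderiv ℝ (fderiv ℝ P) z (hlift s z a) (0, b) - fderiv ℝ (fderiv ℝ P) z (hlift s z b) (0, a)

/-- The 1-form `θₐ = P Pₐ - δₐ P`. -/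
def projForm (s : E × E → E) (P : E × E → ℝ) (z : E × E) (a : E) : ℝ :=
  P z * fderiv ℝ P z (0, a) - fderiv ℝ P z (hlift s z a)

/-- The sprays `(y, s)` and `(y, s')` on `U` satisfy `s' = s - 2 P y`, with a smooth
1-homogeneous function `P`. -/
structure IsProjectiveOn (U : Set (E × E)) (s s' : E × E → E) (P : E × E → ℝ) : Prop where
  spray : IsSprayOn U s
  smooth : ContDiffOn ℝ ∞ P U
  euler : ∀ z ∈ U, fderiv ℝ P z (liouville z) = (1 : ℝ) • P z
  eq : ∀ z ∈ U, s' z = s z - (2 * P z) • z.2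

theorem hamelForm_neg (s : E × E → E) (P : E × E → ℝ) (z : E × E) (a b : E) :
    hamelForm s (fun z' => -P z') z a b = -hamelForm s P z a b := by
  have h1 : fderiv ℝ (fun z' => -P z') = -fderiv ℝ P := by
    funext z'
    rw [fderiv_fun_neg]; rfl
  rw [hamelForm, hamelForm, h1, fderiv_neg]
  simp only [neg_apply]
  ring

namespace IsProjectiveOn

variable {s s' : E × E → E} {P : E × E → ℝ} (h : IsProjectiveOn U s s' P)
include h

variable {z : E × E} (hz : z ∈ U)
include hz

theorem hess_comm (u w : E × E) :
    fderiv ℝ (fderiv ℝ P) z u w = fderiv ℝ (fderiv ℝ P) z w u :=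
  fderiv_fderiv_comm h.spray.isOpen h.smooth hz u w

theorem hess_liouville (u : E × E) :
    fderiv ℝ (fderiv ℝ P) z u (0, z.2) = fderiv ℝ P z u - fderiv ℝ P z (0, u.2) := by
  have := euler_fderiv h.spray.isOpen h.smooth h.euler hz u
  rwa [one_smul] at this

theorem fderiv_self : fderiv ℝ P z (0, z.2) = P z := by
  have := h.euler z hz
  rwa [one_smul] at this

theorem fderiv_vert (b : E) (u : E × E) :
    fderiv ℝ (fun z' => fderiv ℝ P z' (0, b)) z u = fderiv ℝ (fderiv ℝ P) z u (0, b) :=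
  fderiv_apply_const
    (differentiableAt_of_smooth h.spray.isOpen (contDiffOn_fderiv h.spray.isOpen h.smooth) hz) _ _

theorem connMap_eq (b : E) :
    connMap s' z b = connMap s z b - (fderiv ℝ P z (0, b) • z.2 + P z • b) := by
  have d1 := (differentiableAt_of_smooth h.spray.isOpen h.spray.smooth hz).hasFDerivAt
  have d2 := (differentiableAt_of_smooth h.spray.isOpen h.smooth hz).hasFDerivAt
  have d3 : HasFDerivAt (fun z' : E × E => z'.2) (ContinuousLinearMap.snd ℝ E E) z :=
    hasFDerivAt_snd
  have d := d1.sub ((d2.const_mul 2).smul d3)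
  have e : fderiv ℝ s' z (0, b)
      = fderiv ℝ s z (0, b) - ((2 * P z) • b + (2 * fderiv ℝ P z (0, b)) • z.2) := by
    rw [fderiv_congr_on h.spray.isOpen h.eq hz]
    exact (DFunLike.congr_fun d.fderiv (0, b)).trans (by simp)
  rw [connMap_apply, connMap_apply, e]
  module

theorem hlift_eq (a : E) :
    hlift s' z a = hlift s z a - fderiv ℝ P z (0, a) • (0, z.2) - P z • (0, a) := by
  rw [hlift_apply, hlift_apply, h.connMap_eq hz]
  simp [sub_sub]

theorem fderiv_connMap_eq (hs' : IsSprayOn U s') (b : E) (u : E × E) :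
    fderiv ℝ (connMap s') z u b = fderiv ℝ (connMap s) z u b
      - (fderiv ℝ (fderiv ℝ P) z u (0, b) • z.2 + fderiv ℝ P z (0, b) • u.2
        + fderiv ℝ P z u • b) := by
  have hU := h.spray.isOpen
  have c1 := differentiableAt_of_smooth hU h.spray.smooth_connMap hz
  have c2 := differentiableAt_of_smooth hU hs'.smooth_connMap hz
  have p2 := differentiableAt_of_smooth hU (contDiffOn_fderiv hU h.smooth) hz
  have d1 := (c1.clm_apply (differentiableAt_const b)).hasFDerivAt
  have d2 := (differentiableAt_of_smooth hU h.smooth hz).hasFDerivAt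
  have d3 : HasFDerivAt (fun z' : E × E => z'.2) (ContinuousLinearMap.snd ℝ E E) z :=
    hasFDerivAt_snd
  have d4 := (p2.clm_apply (differentiableAt_const ((0 : E), b))).hasFDerivAt
  have d := d1.sub ((d4.smul d3).add (d2.smul_const b))
  rw [← fderiv_apply_const c2, fderiv_congr_on hU (fun z' hz' => h.connMap_eq hz' b) hz]
  refine (DFunLike.congr_fun d.fderiv u).trans ?_
  simp [fderiv_apply_const c1, h.fderiv_vert hz, add_comm]

/-- The change of curvature under a projective change. -/
theorem curv_eq (hs' : IsSprayOn U s') (a b : E) :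
    curv s' z a b = curv s z a b - hamelForm s P z a b • z.2
      + (projForm s P z a • b - projForm s P z b • a) := by
  have e := h.hess_liouville hz
  have hvert : ∀ b : E, fderiv ℝ (fderiv ℝ P) z (0, z.2) (0, b) = 0 := by
    intro b
    rw [h.hess_comm hz, e, sub_self]
  have hL := h.spray.fderiv_connMap_liouville hz
  rw [liouville] at hL
  simp only [curv, h.fderiv_connMap_eq hz hs', h.hlift_eq hz]
  simp only [map_sub, map_smul, sub_apply, smul_apply, hL, hvert, h.fderiv_self hz, smul_eq_mul,
    Prod.snd_sub, Prod.smul_snd]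
  rw [h.spray.fderiv_connMap_vertical_comm hz b a, h.hess_comm hz (0, b) (0, a)]
  simp only [hamelForm, projForm, hlift_apply]
  module

/-- `d_h d_J P` does not change under the projective change with factor `P` itself. -/
theorem hamelForm_eq (a b : E) : hamelForm s' P z a b = hamelForm s P z a b := by
  have hvert : ∀ b : E, fderiv ℝ (fderiv ℝ P) z (0, z.2) (0, b) = 0 := by
    intro b
    rw [h.hess_comm hz, h.hess_liouville hz, sub_self]
  simp only [hamelForm, h.hlift_eq hz, map_sub, map_smul, sub_apply, smul_apply, hvert,
    smul_eq_mul]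
  rw [h.hess_comm hz (0, b) (0, a)]
  ring

/-- Hamel's equation, contracted with the spray, reads `∂(S P)/∂y (b) = 2 δ_b P`. -/
theorem fderiv_spray_of_hamel (hH : ∀ a b, hamelForm s P z a b = 0) (b : E) :
    fderiv ℝ (fun z' => fderiv ℝ P z' (z'.2, s z')) z (0, b)
      = 2 * fderiv ℝ P z (hlift s z b) := by
  have hU := h.spray.isOpen
  have p2 := differentiableAt_of_smooth hU (contDiffOn_fderiv hU h.smooth) hz
  have s1 := differentiableAt_of_smooth hU h.spray.smooth hz
  have h2 : DifferentiableAt ℝ (fun z' : E × E => z'.2) z := differentiableAt_snd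
  rw [fderiv_apply_field p2 (h2.prodMk s1), h2.fderiv_prodMk s1, fderiv_snd]
  have h0 := hH z.2 b
  rw [hamelForm, h.hess_liouville hz, h.spray.hlift_self hz, h.hess_comm hz] at h0
  have e1 : (ContinuousLinearMap.prod (ContinuousLinearMap.snd ℝ E E) (fderiv ℝ s z)) (0, b)
      = (2 : ℝ) • hlift s z b - (b, 0) := by
    rw [hlift_apply, connMap_apply]
    ext
    · simp [two_smul]
    · simp
  have e2 : ((0 : E), (hlift s z b).2) = hlift s z b - (b, 0) := by
    simp [hlift_apply]
  rw [e2] at h0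
  rw [e1]
  simp only [map_sub, map_smul, smul_eq_mul] at h0 ⊢
  linarith

end IsProjectiveOn

end Projective

/-! ### Constant flag curvature and Hamel's equation, locally -/

section Beltrami

variable {E : Type*} [NormedAddCommGroup E] [NormedSpace ℝ E] [FiniteDimensional ℝ E]
  {U : Set (E × E)}

/-- If two projectively related metrics have constant flag curvatures, the projective factor
satisfies Hamel's equation. -/
theorem hamelForm_eq_zero_of_flagCurvature_eq (hn : 2 < Module.finrank ℝ E)
    {L L' P : E × E → ℝ} (hL : IsFinslerOn U L) (hL' : IsFinslerOn U L')
    (hP : IsProjectiveOn U (sprayVert L) (sprayVert L') P) {κ κ' : ℝ}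
    (h : ∀ z ∈ U, ∀ X : E, LinearIndependent ℝ ![z.2, X] → flagCurvature L z X = κ)
    (h' : ∀ z ∈ U, ∀ X : E, LinearIndependent ℝ ![z.2, X] → flagCurvature L' z X = κ')
    {z : E × E} (hz : z ∈ U) (a b : E) : hamelForm (sprayVert L) P z a b = 0 := by
  set φ : E → ℝ := fun a => κ' / 2 * fderiv ℝ L' z (0, a) - κ / 2 * fderiv ℝ L z (0, a)
    - projForm (sprayVert L) P z a with hφ
  have key : ∀ a b : E, φ a • b - φ b • a + hamelForm (sprayVert L) P z a b • z.2 = 0 := by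
    intro a b
    have e := hP.curv_eq hz hL'.isSprayOn a b
    rw [hL.curv_eq_of_flagCurvature_eq h hz, hL'.curv_eq_of_flagCurvature_eq h' hz,
      ← sub_eq_zero] at e
    rw [← e, hφ]
    module
  have hφ0 : ∀ a, φ a = 0 := by
    intro a
    obtain ⟨b, hb⟩ := exists_notMem_span_pair hn a z.2
    refine eq_zero_of_smul_mem hb (Submodule.mem_span_pair.2
      ⟨φ b, -hamelForm (sprayVert L) P z a b, ?_⟩)
    rw [← sub_eq_zero, ← neg_eq_zero, ← key a b]
    module
  have := key a b
  rw [hφ0, hφ0, zero_smul, zero_smul, sub_zero, zero_add, smul_eq_zero] at this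
  exact this.resolve_right (hL.snd_ne_zero z hz)

/-- The factor `(κ F² + P² - S P) / F̃²`: the flag curvature of `F̃` when `F` has constant flag
curvature `κ` and the projective factor `P` satisfies Hamel's equation. -/
def projFactor (κ : ℝ) (L L' P : E × E → ℝ) (z : E × E) : ℝ :=
  (κ * L z + P z ^ 2 - fderiv ℝ P z (spray L z)) / L' z

section Hamel

variable (hn : 2 < Module.finrank ℝ E)
  {L L' P : E × E → ℝ} (hL : IsFinslerOn U L) (hL' : IsFinslerOn U L')
  (hP : IsProjectiveOn U (sprayVert L) (sprayVert L') P) {κ : ℝ}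
  (h : ∀ z ∈ U, ∀ X : E, LinearIndependent ℝ ![z.2, X] → flagCurvature L z X = κ)
  (hH : ∀ z ∈ U, ∀ a b, hamelForm (sprayVert L) P z a b = 0)
include hL hL' hP h hH

/-- The 1-form `σ = κ g(y, ·) + θ` that carries the curvature of the second metric is a multiple of
`g̃(y, ·)`, because the curvature of the second metric preserves that metric. -/
theorem curvForm_eq_projFactor {z : E × E} (hz : z ∈ U) (a : E) :
    κ / 2 * fderiv ℝ L z (0, a) + projForm (sprayVert L) P z a
      = projFactor κ L L' P z / 2 * fderiv ℝ L' z (0, a) := by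
  have hpos := hL'.pos hz
  have e := hP.curv_eq hz hL'.isSprayOn a z.2
  rw [hL.curv_eq_of_flagCurvature_eq h hz, hH z hz, zero_smul, sub_zero] at e
  have h0 := hL'.fderiv_curv_eq_zero hz a z.2
  have e1 : ((0 : E), curv (sprayVert L') z a z.2)
      = (κ / 2 * fderiv ℝ L z (0, a) + projForm (sprayVert L) P z a) • (0, z.2)
        - (κ / 2 * fderiv ℝ L z (0, z.2) + projForm (sprayVert L) P z z.2) • (0, a) := by
    rw [e]
    ext
    · simp
    · simp only [Prod.snd_sub, Prod.smul_snd]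
      module
  have e2 : projForm (sprayVert L) P z z.2 = P z ^ 2 - fderiv ℝ P z (spray L z) := by
    rw [projForm, hP.fderiv_self hz, hL.isSprayOn.hlift_self hz, ← hL.spray_eq hz]
    ring
  rw [e1, e2, map_sub, map_smul, map_smul, hL'.fderiv_vert_self hz, hL.fderiv_vert_self hz,
    smul_eq_mul, smul_eq_mul] at h0
  rw [projFactor]
  field_simp
  linarith

theorem curv_eq_projFactor {z : E × E} (hz : z ∈ U) (a b : E) :
    curv (sprayVert L') z a b = (projFactor κ L L' P z / 2 * fderiv ℝ L' z (0, a)) • b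
      - (projFactor κ L L' P z / 2 * fderiv ℝ L' z (0, b)) • a := by
  rw [hP.curv_eq hz hL'.isSprayOn, hL.curv_eq_of_flagCurvature_eq h hz, hH z hz,
    ← curvForm_eq_projFactor hL hL' hP h hH hz, ← curvForm_eq_projFactor hL hL' hP h hH hz]
  module

theorem flagCurvature_eq_projFactor {z : E × E} (hz : z ∈ U) {X : E}
    (hX : LinearIndependent ℝ ![z.2, X]) :
    flagCurvature L' z X = projFactor κ L L' P z := by
  refine (hL'.forall_flagCurvature_eq_iff hz _).2 (fun b => ?_) X hX
  rw [curv_eq_projFactor hL hL' hP h hH hz, hL'.fderiv_vert_self hz]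
  module

omit hP h hH in
theorem smooth_projFactor (hP : ContDiffOn ℝ ∞ P U) : ContDiffOn ℝ ∞ (projFactor κ L L' P) U := by
  have hS : ContDiffOn ℝ ∞ (spray L) U := fun z hz => (hL.contDiffAt_spray hz).contDiffWithinAt
  exact (((contDiffOn_const.mul hL.smooth).add (hP.pow 2)).sub
    ((contDiffOn_fderiv hL.isOpen hP).clm_apply hS)).div hL'.smooth
      fun z hz => (hL'.pos hz).ne'

theorem fderiv_projFactor_vert {z : E × E} (hz : z ∈ U) (a : E) :
    fderiv ℝ (projFactor κ L L' P) z (0, a) = 0 := by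
  have hU := hL.isOpen
  have hK := differentiableAt_of_smooth hU (smooth_projFactor (κ := κ) hL hL' hP.smooth) hz
  have hL1 := differentiableAt_of_smooth hU hL'.smooth hz
  -- `ρ = K F̃²` has fibre derivative `2 σ`
  have hρ : ∀ z ∈ U, projFactor κ L L' P z * L' z
      = κ * L z + P z ^ 2 - fderiv ℝ P z (z.2, sprayVert L z) := by
    intro z hz
    rw [projFactor, div_mul_cancel₀ _ (hL'.pos hz).ne', hL.spray_eq hz]
  have e := DFunLike.congr_fun (fderiv_congr_on hU hρ hz) (0, a)
  have hSd : DifferentiableAt ℝ (fun z' => fderiv ℝ P z' (z'.2, sprayVert L z')) z :=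
    (differentiableAt_of_smooth hU (contDiffOn_fderiv hU hP.smooth) hz).clm_apply
      (differentiableAt_snd.prodMk (differentiableAt_of_smooth hU hL.smooth_sprayVert hz))
  have d1 := (differentiableAt_of_smooth hU hL.smooth hz).hasFDerivAt.const_mul κ
  have d2 := (differentiableAt_of_smooth hU hP.smooth hz).hasFDerivAt.pow 2
  have d := ((d1.add d2).sub hSd.hasFDerivAt).fderiv
  have e' : fderiv ℝ (fun z' => κ * L z' + P z' ^ 2 - fderiv ℝ P z' (z'.2, sprayVert L z')) z (0, a)
      = κ * fderiv ℝ L z (0, a) + 2 * P z * fderiv ℝ P z (0, a)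
        - 2 * fderiv ℝ P z (hlift (sprayVert L) z a) := by
    refine (DFunLike.congr_fun d (0, a)).trans ?_
    simp [hP.fderiv_spray_of_hamel hz (hH z hz)]
  rw [e', fderiv_fun_mul hK hL1] at e
  have hσ := curvForm_eq_projFactor hL hL' hP h hH hz a
  rw [projForm] at hσ
  simp only [add_apply, smul_apply, smul_eq_mul] at e
  have : L' z * fderiv ℝ (projFactor κ L L' P) z (0, a) = 0 := by linarith
  exact (mul_eq_zero.1 this).resolve_left (hL'.pos hz).ne'

include hn in
theorem fderiv_projFactor {z : E × E} (hz : z ∈ U) : fderiv ℝ (projFactor κ L L' P) z = 0 :=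
  hL'.fderiv_eq_zero_of_isotropic hn (smooth_projFactor hL hL' hP.smooth)
    (fun _ hz a => fderiv_projFactor_vert hL hL' hP h hH hz a)
    (fun _ hz a b => curv_eq_projFactor hL hL' hP h hH hz a b) hz

end Hamel

/-- In coordinates `d_h d_J P` is the form `δₐ P_b - δ_b Pₐ`. -/
theorem dEnd_horProj_spray {L P : E × E → ℝ} (hL : IsFinslerOn U L) (hP : ContDiffOn ℝ ∞ P U)
    {z : E × E} (hz : z ∈ U) (u w : E × E) :
    dEnd (horProj (spray L)) (dJ P) z u w = hamelForm (sprayVert L) P z u.1 w.1 := by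
  have hU := hL.isOpen
  have e : extD (fun z' => (dJ P z').comp (horProj (spray L) z')) z = extD (dJ P) z := by
    have : ∀ z' ∈ U, (dJ P z').comp (horProj (spray L) z') = dJ P z' := by
      intro z' hz'
      refine ContinuousLinearMap.ext fun v => ?_
      rw [ContinuousLinearMap.comp_apply, hL.horProj_spray hz']
      simp [dJ, vertEnd, hlift_apply]
    rw [extD, extD, fderiv_congr_on hU this hz]
  rw [dEnd, e]
  simp only [extD_dJ_apply hU hP hz, hL.horProj_spray hz, hamelForm, hlift_apply]
  ring

end Beltrami

/-! ### Positive definiteness of the metric tensor -/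

section Positivity

theorem deriv_deriv_nonneg_of_isLocalMin {f : ℝ → ℝ} {t : ℝ} (hc : ContinuousAt f t)
    (hf : IsLocalMin f t) : 0 ≤ deriv (deriv f) t := by
  by_contra! hneg
  have hmax := isLocalMax_of_deriv_deriv_neg hneg hf.deriv_eq_zero hc
  -- a local minimum that is a local maximum makes `f` locally constant
  have h1 : f =ᶠ[nhds t] fun _ => f t := by
    filter_upwards [hf, hmax] with x h1 h2 using le_antisymm h2 h1
  have h2 : deriv f =ᶠ[nhds t] fun _ => 0 := by
    filter_upwards [h1.deriv] with x hx
    rw [hx, deriv_const]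
  rw [h2.deriv_eq, deriv_const] at hneg
  exact hneg.false

variable {E : Type*} [NormedAddCommGroup E] [InnerProductSpace ℝ E] [FiniteDimensional ℝ E]
  {U : Set (E × E)} {L : E × E → ℝ} {x : E}

/-- At a direction `y` minimising `L(x, y) / ‖y‖²` the fibre Hessian is positive definite. -/
theorem exists_hess_pos [Nontrivial E] (hU : IsOpen U) (hL : ContDiffOn ℝ ∞ L U)
    (hx : ∀ y : E, y ≠ 0 → (x, y) ∈ U) (hpos : ∀ y : E, y ≠ 0 → 0 < L (x, y))
    (hhom : ∀ y : E, y ≠ 0 → ∀ c : ℝ, 0 < c → L (x, c • y) = c ^ 2 * L (x, y)) :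
    ∃ y : E, y ≠ 0 ∧ ∀ u : E, u ≠ 0 → 0 < fderiv ℝ (fderiv ℝ L) (x, y) (0, u) (0, u) := by
  have hne : ∀ y ∈ Metric.sphere (0 : E) 1, y ≠ 0 := by
    rintro y hy rfl
    simp at hy
  have hcont : ContinuousOn (fun y => L (x, y)) (Metric.sphere (0 : E) 1) :=
    hL.continuousOn.comp (by fun_prop) fun y hy => hx y (hne y hy)
  obtain ⟨y₀, hy₀, hmin⟩ := (isCompact_sphere (0 : E) 1).exists_isMinOn
    (NormedSpace.sphere_nonempty.2 zero_le_one) hcont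
  have h0 := hne y₀ hy₀
  have hnorm : ‖y₀‖ = 1 := by simpa using hy₀
  set c := L (x, y₀) with hc
  have hcpos : 0 < c := hpos y₀ h0
  have hbound : ∀ y : E, y ≠ 0 → c * ‖y‖ ^ 2 ≤ L (x, y) := by
    intro y hy
    have hn : 0 < ‖y‖ := norm_pos_iff.2 hy
    have hmem : ‖y‖⁻¹ • y ∈ Metric.sphere (0 : E) 1 := by
      simp [norm_smul, hn.ne']
    have h1 := hhom _ (hne _ hmem) ‖y‖ hn
    rw [smul_smul, mul_inv_cancel₀ hn.ne', one_smul] at h1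
    rw [h1, mul_comm]
    exact mul_le_mul_of_nonneg_left (hmin hmem) (by positivity)
  refine ⟨y₀, h0, fun u hu => ?_⟩
  -- second derivative test along the line `y₀ + t u` for `L - c ‖·‖²`, which is minimal at `t = 0`
  set γ : ℝ → E := fun t => y₀ + t • u with hγ
  have hγd : ∀ t, HasDerivAt γ u t := fun t =>
    (((hasDerivAt_id t).smul_const u).const_add y₀).congr_deriv (one_smul ℝ u)
  have hγ0 : γ 0 = y₀ := by simp [hγ]
  have hγne : ∀ᶠ t in nhds (0 : ℝ), γ t ≠ 0 := by
    refine (hγd 0).continuousAt.eventually_ne ?_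
    rwa [hγ0]
  have hγ2 : ∀ t, HasDerivAt (fun t => (x, γ t)) ((0 : E), u) t := fun t =>
    (hasDerivAt_const t x).prodMk (hγd t)
  set f : ℝ → ℝ := fun t => L (x, γ t) - c * ‖γ t‖ ^ 2 with hf
  have hfd : ∀ t, γ t ≠ 0 →
      HasDerivAt f (fderiv ℝ L (x, γ t) (0, u) - c * (2 * inner ℝ (γ t) u)) t := by
    intro t ht
    have d1 := (differentiableAt_of_smooth hU hL (hx _ ht)).hasFDerivAt.comp_hasDerivAt t (hγ2 t)
    exact d1.sub ((hγd t).norm_sq.const_mul c)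
  have hfmin : IsLocalMin f 0 := by
    filter_upwards [hγne] with t ht
    have : f 0 = 0 := by simp [hf, hγ0, hnorm, hc]
    rw [this]
    exact sub_nonneg.2 (hbound _ ht)
  have h2 := deriv_deriv_nonneg_of_isLocalMin
    (hfd 0 (by rwa [hγ0])).continuousAt hfmin
  have hd : deriv f =ᶠ[nhds 0]
      fun t => fderiv ℝ L (x, γ t) (0, u) - c * (2 * inner ℝ (γ t) u) := by
    filter_upwards [hγne] with t ht using (hfd t ht).deriv
  have hx0 : (x, γ 0) ∈ U := by
    rw [hγ0]; exact hx _ h0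
  have d2 := (differentiableAt_of_smooth hU (contDiffOn_fderiv hU hL)
    hx0).hasFDerivAt.comp_hasDerivAt 0 (hγ2 0)
  have d3 := d2.clm_apply (hasDerivAt_const (0 : ℝ) ((0 : E), u))
  have d4 := (((hγd 0).inner ℝ (hasDerivAt_const (0 : ℝ) u)).const_mul 2).const_mul c
  have d5 := (d3.sub d4).deriv
  rw [hd.deriv_eq] at h2
  have e := h2.trans_eq d5
  simp only [map_zero, add_zero, inner_zero_right, zero_add, hγ0,
    real_inner_self_eq_norm_sq] at e
  have hn : 0 < ‖u‖ := norm_pos_iff.2 hu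
  have : 0 < c * (2 * ‖u‖ ^ 2) := by positivity
  linarith

/-- A nondegenerate fibre Hessian of a positive 2-homogeneous function is positive definite: the
set of nonzero directions is connected, and the Hessian is positive definite at one of them. -/
theorem hess_pos_of_nondegenerate (hn : 1 < Module.finrank ℝ E) (hU : IsOpen U)
    (hL : ContDiffOn ℝ ∞ L U)
    (hx : ∀ y : E, y ≠ 0 → (x, y) ∈ U) (hpos : ∀ y : E, y ≠ 0 → 0 < L (x, y))
    (hhom : ∀ y : E, y ≠ 0 → ∀ c : ℝ, 0 < c → L (x, c • y) = c ^ 2 * L (x, y))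
    (hnd : ∀ y : E, y ≠ 0 → ∀ u : E,
      (∀ w : E, fderiv ℝ (fderiv ℝ L) (x, y) (0, u) (0, w) = 0) → u = 0)
    {y : E} (hy : y ≠ 0) {u : E} (hu : u ≠ 0) :
    0 < fderiv ℝ (fderiv ℝ L) (x, y) (0, u) (0, u) := by
  have : Nontrivial E := Module.nontrivial_of_finrank_pos (R := ℝ) (by omega)
  set G : E → E → E → ℝ := fun y u w => fderiv ℝ (fderiv ℝ L) (x, y) (0, u) (0, w) with hG
  have hcont : ContinuousOn (fun p : E × E => G p.1 p.2 p.2) {p | p.1 ≠ 0} := by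
    have h1 : ContinuousOn (fun p : E × E => fderiv ℝ (fderiv ℝ L) (x, p.1)) {p | p.1 ≠ 0} :=
      (contDiffOn_fderiv hU (contDiffOn_fderiv hU hL)).continuousOn.comp (by fun_prop)
        fun p hp => hx _ hp
    have h2 : ContinuousOn (fun p : E × E => ((0 : E), p.2)) {p | p.1 ≠ 0} := by fun_prop
    exact (h1.clm_apply h2).clm_apply h2
  have hopen : IsOpen {p : E × E | p.1 ≠ 0} := isOpen_ne.preimage continuous_fst
  have hcat : ∀ y u : E, y ≠ 0 → ContinuousAt (fun p : E × E => G p.1 p.2 p.2) (y, u) :=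
    fun y u hy => hcont.continuousAt (hopen.mem_nhds hy)
  set A : Set E := {y | y ≠ 0 ∧ ∀ u ∈ Metric.sphere (0 : E) 1, 0 < G y u u} with hA
  have hAall : ∀ y ∈ A, ∀ u : E, u ≠ 0 → 0 < G y u u := by
    intro y hy u hu
    have hn : 0 < ‖u‖ := norm_pos_iff.2 hu
    have h := hy.2 (‖u‖⁻¹ • u) (by simp [norm_smul, hn.ne'])
    have e : ((0 : E), ‖u‖⁻¹ • u) = ‖u‖⁻¹ • (0, u) := by simp
    simp only [hG, e, map_smul, smul_apply, smul_eq_mul] at h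
    have hi : 0 < ‖u‖⁻¹ := by positivity
    exact pos_of_mul_pos_right (pos_of_mul_pos_right h hi.le) hi.le
  have hAopen : IsOpen A := by
    rw [isOpen_iff_mem_nhds]
    intro y hy
    refine Filter.inter_mem (isOpen_ne.mem_nhds hy.1)
      ((isCompact_sphere (0 : E) 1).eventually_forall_of_forall_eventually fun u hu => ?_)
    exact (hcat y u hy.1).eventually (lt_mem_nhds (hy.2 u hu))
  have hsub : ({0}ᶜ : Set E) ⊆ A := by
    refine IsPreconnected.subset_of_closure_inter_subset
      (isConnected_compl_singleton_of_one_lt_rank ?_ 0).isPreconnected hAopen ?_ ?_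
    · rw [← Module.finrank_eq_rank]; exact_mod_cast hn
    · obtain ⟨y, hy, h⟩ := exists_hess_pos hU hL hx hpos hhom
      refine ⟨y, hy, hy, fun u hu => h u ?_⟩
      rintro rfl
      simp at hu
    · rintro y ⟨hyc, hy⟩
      have hy : y ≠ 0 := hy
      have hnonneg : ∀ u : E, 0 ≤ G y u u := by
        intro u
        by_cases hu : u = 0
        · simp only [hG, hu, Prod.mk_zero_zero, map_zero, le_refl]
        have hc : ContinuousAt (fun y => G y u u) y :=
          ContinuousAt.comp (f := fun y => (y, u)) (g := fun p : E × E => G p.1 p.2 p.2)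
            (hcat y u hy) (by fun_prop)
        have hfr : ∃ᶠ y' in nhds y, 0 ≤ G y' u u :=
          (mem_closure_iff_frequently.1 hyc).mono fun y' hy' => (hAall y' hy' u hu).le
        exact ge_of_tendsto_of_frequently hc hfr
      refine ⟨hy, fun u hu => (hnonneg u).lt_of_ne fun h0 => ?_⟩
      have hu0 : u = 0 := hnd y hy u fun w => by
        -- a null vector of a positive semidefinite form is in its kernel
        have hq : ∀ t : ℝ, 0 ≤ G y w w * (t * t) + 2 * G y u w * t + 0 := by
          intro t
          have h := hnonneg (u + t • w)
          have e : ((0 : E), u + t • w) = (0, u) + t • (0, w) := by simp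
          have hs : G y w u = G y u w :=
            fderiv_fderiv_comm hU hL (hx y hy) _ _
          simp only [hG] at h h0 hs ⊢
          simp only [e, map_add, map_smul, add_apply, smul_apply, smul_eq_mul, ← h0, hs] at h
          linarith
        have hd := discrim_le_zero hq
        rw [discrim] at hd
        have : G y u w = 0 := by nlinarith [sq_nonneg (G y u w)]
        exact this
      rw [hu0] at hu
      simp at hu
  exact hAall y (hsub hy) u hu

end Positivity

/-! ### Naturality of the geodesic spray -/

section Naturality

variable {E : Type*} [NormedAddCommGroup E] [NormedSpace ℝ E] {V : Set E} {φ : E → E}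

/-- The tangent map `(x, y) ↦ (φ x, Dφ(x) y)`. -/
def tangMap (φ : E → E) (z : E × E) : E × E := (φ z.1, fderiv ℝ φ z.1 z.2)

theorem smooth_tangMap (hV : IsOpen V) (hφ : ContDiffOn ℝ ∞ φ V) :
    ContDiffOn ℝ ∞ (tangMap φ) (Prod.fst ⁻¹' V) :=
  (hφ.comp contDiffOn_fst fun _ hz => hz).prodMk
    (((contDiffOn_fderiv hV hφ).comp contDiffOn_fst fun _ hz => hz).clm_apply contDiffOn_snd)

theorem fderiv_tangMap (hV : IsOpen V) (hφ : ContDiffOn ℝ ∞ φ V) {z : E × E} (hz : z.1 ∈ V)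
    (u : E × E) : fderiv ℝ (tangMap φ) z u
      = (fderiv ℝ φ z.1 u.1, fderiv ℝ (fderiv ℝ φ) z.1 u.1 z.2 + fderiv ℝ φ z.1 u.2) := by
  have h1 : HasFDerivAt (fun z' : E × E => z'.1) (ContinuousLinearMap.fst ℝ E E) z :=
    hasFDerivAt_fst
  have h2 : HasFDerivAt (fun z' : E × E => z'.2) (ContinuousLinearMap.snd ℝ E E) z :=
    hasFDerivAt_snd
  have d1 := (differentiableAt_of_smooth hV hφ hz).hasFDerivAt.comp z h1
  have d2 := (differentiableAt_of_smooth hV (contDiffOn_fderiv hV hφ) hz).hasFDerivAt.comp z h1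
  have d := (d1.prodMk (d2.clm_apply h2)).fderiv
  exact (DFunLike.congr_fun d u).trans (by simp [add_comm])

variable {L L' : E × E → ℝ} {U U' : Set (E × E)}

/-- The form `dd_J L` is natural under tangent maps. -/
theorem extD_dJ_comp_tangMap (hV : IsOpen V) (hφ : ContDiffOn ℝ ∞ φ V) (hU : IsOpen U)
    (hUV : ∀ z ∈ U, z.1 ∈ V) (hU' : IsOpen U') (hL' : ContDiffOn ℝ ∞ L' U')
    (hmaps : ∀ z ∈ U, tangMap φ z ∈ U') (heq : ∀ z ∈ U, L z = L' (tangMap φ z))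
    {z : E × E} (hz : z ∈ U) (u w : E × E) :
    extD (dJ L) z u w = extD (dJ L') (tangMap φ z) (fderiv ℝ (tangMap φ) z u)
      (fderiv ℝ (tangMap φ) z w) := by
  have hT : ContDiffOn ℝ ∞ (tangMap φ) U := (smooth_tangMap hV hφ).mono hUV
  have hT1 := contDiffOn_fderiv hU hT
  have hd : ∀ z ∈ U, fderiv ℝ L z
      = (fderiv ℝ L' (tangMap φ z)).comp (fderiv ℝ (tangMap φ) z) := by
    intro z hz
    rw [fderiv_congr_on hU heq hz]
    exact fderiv_comp z (differentiableAt_of_smooth hU' hL' (hmaps z hz))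
      (differentiableAt_of_smooth hU hT hz)
  -- the tangent map commutes with the vertical endomorphism
  have hJ : ∀ z ∈ U, dJ L z = (dJ L' (tangMap φ z)).comp (fderiv ℝ (tangMap φ) z) := by
    intro z hz
    refine ContinuousLinearMap.ext fun w => ?_
    simp [dJ, hd z hz, fderiv_tangMap hV hφ (hUV z hz), vertEnd]
  have hJ' : ContDiffOn ℝ ∞ (dJ L') U' := (contDiffOn_fderiv hU' hL').clm_comp contDiffOn_const
  have hJd := differentiableAt_of_smooth hU' hJ' (hmaps z hz)
  have hTd := differentiableAt_of_smooth hU hT hz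
  have hcomp : HasFDerivAt (fun z' => dJ L' (tangMap φ z'))
      ((fderiv ℝ (dJ L') (tangMap φ z)).comp (fderiv ℝ (tangMap φ) z)) z :=
    hJd.hasFDerivAt.comp z hTd.hasFDerivAt
  have hT1d := differentiableAt_of_smooth hU hT1 hz
  have key : ∀ u w : E × E, fderiv ℝ (dJ L) z u w
      = fderiv ℝ (dJ L') (tangMap φ z) (fderiv ℝ (tangMap φ) z u) (fderiv ℝ (tangMap φ) z w)
        + dJ L' (tangMap φ z) (fderiv ℝ (fderiv ℝ (tangMap φ)) z u w) := by
    intro u w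
    rw [fderiv_congr_on hU hJ hz]
    have d := (hcomp.clm_comp hT1d.hasFDerivAt).fderiv
    rw [d]
    simp [add_comm]
  have hsym := fderiv_fderiv_comm hU hT hz u w
  simp only [extD, sub_apply, ContinuousLinearMap.flip_apply, key, hsym]
  ring

/-- The geodesic spray is natural under tangent maps. -/
theorem spray_tangMap [FiniteDimensional ℝ E] (hV : IsOpen V) (hφ : ContDiffOn ℝ ∞ φ V)
    (hL : IsFinslerOn U L) (hL' : IsFinslerOn U' L')
    (hmaps : ∀ z ∈ U, z.1 ∈ V → tangMap φ z ∈ U')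
    (heq : ∀ z ∈ U, z.1 ∈ V → L z = L' (tangMap φ z))
    {z : E × E} (hz : z ∈ U) (hzV : z.1 ∈ V) (hsurj : Function.Surjective (fderiv ℝ φ z.1)) :
    spray L' (tangMap φ z) = fderiv ℝ (tangMap φ) z (spray L z) := by
  have hW : IsOpen (U ∩ Prod.fst ⁻¹' V) := hL.isOpen.inter (hV.preimage continuous_fst)
  have hzW : z ∈ U ∩ Prod.fst ⁻¹' V := ⟨hz, hzV⟩
  have hT : ContDiffOn ℝ ∞ (tangMap φ) (U ∩ Prod.fst ⁻¹' V) :=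
    (smooth_tangMap hV hφ).mono Set.inter_subset_right
  refine (hL'.spray_unique (hmaps z hz hzV) (ContinuousLinearMap.ext fun w' => ?_)).symm
  obtain ⟨w, rfl⟩ : ∃ w, fderiv ℝ (tangMap φ) z w = w' := by
    obtain ⟨a, ha⟩ := hsurj w'.1
    obtain ⟨b, hb⟩ := hsurj (w'.2 - fderiv ℝ (fderiv ℝ φ) z.1 a z.2)
    refine ⟨(a, b), ?_⟩
    rw [fderiv_tangMap hV hφ hzV, ha, hb]
    simp
  rw [← extD_dJ_comp_tangMap hV hφ hW (fun z hz => hz.2) hL'.isOpen hL'.smooth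
    (fun z hz => hmaps z hz.1 hz.2) (fun z hz => heq z hz.1 hz.2) hzW, hL.spray_spec hz,
    neg_apply, neg_apply, fderiv_congr_on hW (fun z hz => heq z hz.1 hz.2) hzW]
  have := fderiv_comp z (differentiableAt_of_smooth hL'.isOpen hL'.smooth (hmaps z hz hzV))
    (differentiableAt_of_smooth hW hT hzW)
  exact congrArg Neg.neg (DFunLike.congr_fun this w)

end Naturality

/-! ### Induced coordinates on the tangent bundle -/

section Manifold

variable {n : ℕ} {M : Type*} [TopologicalSpace M] [ChartedSpace (EuclideanSpace ℝ (Fin n)) M]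
  [IsManifold (𝓡 n) ∞ M]

local notation "𝔼" => EuclideanSpace ℝ (Fin n)

theorem inducedChart_apply (p : M) (v : TangentBundle (𝓡 n) M) :
    inducedChart p v
      = (extChartAt (𝓡 n) p v.1, tangentCoordChange (𝓡 n) v.1 p v.1 v.2) := rfl

theorem inducedChart_symm_apply (p : M) (z : 𝔼 × 𝔼) :
    (inducedChart p).symm z = ⟨(extChartAt (𝓡 n) p).symm z.1,
      tangentCoordChange (𝓡 n) p ((extChartAt (𝓡 n) p).symm z.1)
        ((extChartAt (𝓡 n) p).symm z.1) z.2⟩ := rfl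

theorem mem_inducedChart_target {p : M} {z : 𝔼 × 𝔼} :
    z ∈ (inducedChart (n := n) p).target ↔ z.1 ∈ (extChartAt (𝓡 n) p).target := by
  simp [inducedChart, extChartAt]
  exact TangentBundle.mem_chart_target_iff (I := 𝓡 n) z ⟨p, 0⟩

theorem mem_inducedChart_source {p : M} {v : TangentBundle (𝓡 n) M} :
    v ∈ (inducedChart (n := n) p).source ↔ v.1 ∈ (extChartAt (𝓡 n) p).source := by
  simp [inducedChart, extChartAt]

theorem mem_slitDomain {p : M} {z : 𝔼 × 𝔼} :
    z ∈ slitDomain n p ↔ z.1 ∈ (extChartAt (𝓡 n) p).target ∧ z.2 ≠ 0 := by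
  rw [slitDomain, Set.mem_ofPred_eq, mem_inducedChart_target]

theorem slitDomain_eq_prod (p : M) :
    slitDomain n p = (extChartAt (𝓡 n) p).target ×ˢ ({0}ᶜ : Set 𝔼) := by
  ext z
  rw [mem_slitDomain]
  rfl

theorem isOpen_slitDomain (p : M) : IsOpen (slitDomain n p) := by
  rw [slitDomain_eq_prod]
  exact (isOpen_extChartAt_target p).prod isOpen_compl_singleton

theorem inducedChart_symm_snd_ne_zero {p : M} {z : 𝔼 × 𝔼} (hz : z ∈ slitDomain n p) :
    ((inducedChart p).symm z).2 ≠ 0 := by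
  rw [mem_slitDomain] at hz
  intro h
  rw [inducedChart_symm_apply] at h
  have hx := (extChartAt (𝓡 n) p).map_target hz.1
  have h1 := tangentCoordChange_comp (I := 𝓡 n) (w := p)
    (x := (extChartAt (𝓡 n) p).symm z.1) (y := p) (v := z.2)
    ⟨⟨hx, mem_extChartAt_source _⟩, hx⟩
  rw [tangentCoordChange_self hx] at h1
  refine hz.2 (h1.symm.trans ?_)
  exact (congrArg _ h).trans (map_zero _)

theorem inducedChart_mem_slitDomain {p : M} {v : TangentBundle (𝓡 n) M}
    (hv : v.1 ∈ (extChartAt (𝓡 n) p).source) (hv0 : v.2 ≠ 0) :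
    inducedChart p v ∈ slitDomain n p := by
  refine mem_slitDomain.2 ⟨(extChartAt (𝓡 n) p).map_source hv, fun h => hv0 ?_⟩
  rw [inducedChart_apply] at h
  have h1 := tangentCoordChange_comp (I := 𝓡 n) (w := v.1) (x := p) (y := v.1) (v := v.2)
    ⟨⟨mem_extChartAt_source _, hv⟩, mem_extChartAt_source _⟩
  have h2 := tangentCoordChange_self (I := 𝓡 n) (v := v.2) (mem_extChartAt_source v.1)
  exact h2.symm.trans (h1.symm.trans ((congrArg _ h).trans (map_zero _)))

theorem smooth_inCoords {f : TangentBundle (𝓡 n) M → ℝ} (hf : SmoothOnSlit f) (p : M) :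
    ContDiffOn ℝ ∞ (inCoords f p) (slitDomain n p) := by
  rw [← contMDiffOn_iff_contDiffOn]
  have h := contMDiffOn_extChartAt_symm (I := (𝓡 n).tangent) (n := ∞)
    (⟨p, 0⟩ : TangentBundle (𝓡 n) M)
  exact hf.comp (h.mono fun z (hz : z ∈ slitDomain n p) => hz.1)
    fun z hz => inducedChart_symm_snd_ne_zero hz

theorem inCoords_smul {f : TangentBundle (𝓡 n) M → ℝ} (hf : PosHomogeneous f) {p : M}
    {z : 𝔼 × 𝔼} (hz : z ∈ slitDomain n p) {c : ℝ} (hc : 0 < c) :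
    inCoords f p (z.1, c • z.2) = c * inCoords f p z := by
  have h := hf _ _ (inducedChart_symm_snd_ne_zero hz) c hc
  simp only [inCoords, inducedChart_symm_apply, map_smul] at h ⊢
  exact h

/-- Euler's identity for a function that is 1-homogeneous on `T₀M`. -/
theorem fderiv_inCoords_liouville {f : TangentBundle (𝓡 n) M → ℝ} (hs : SmoothOnSlit f)
    (hf : PosHomogeneous f) {p : M} {z : 𝔼 × 𝔼} (hz : z ∈ slitDomain n p) :
    fderiv ℝ (inCoords f p) z (liouville z) = inCoords f p z := by
  have hd := differentiableAt_of_smooth (isOpen_slitDomain p) (smooth_inCoords hs p) hz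
  have h1 : HasDerivAt (fun c : ℝ => (z.1, c • z.2)) (liouville z) 1 :=
    (hasDerivAt_const (1 : ℝ) z.1).prodMk
      (((hasDerivAt_id (1 : ℝ)).smul_const z.2).congr_deriv (one_smul ℝ z.2))
  have h2 : HasDerivAt (fun c : ℝ => inCoords f p (z.1, c • z.2))
      (fderiv ℝ (inCoords f p) z (liouville z)) 1 := by
    have hd' : HasFDerivAt (inCoords f p) (fderiv ℝ (inCoords f p) z) (z.1, (1 : ℝ) • z.2) := by
      rw [one_smul]
      exact hd.hasFDerivAt
    exact hd'.comp_hasDerivAt (1 : ℝ) h1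
  have h3 : HasDerivAt (fun c : ℝ => c * inCoords f p z) (inCoords f p z) 1 := by
    simpa using (hasDerivAt_id (1 : ℝ)).mul_const (inCoords f p z)
  refine h2.unique (h3.congr_of_eventuallyEq ?_)
  filter_upwards [lt_mem_nhds (zero_lt_one (α := ℝ))] with c hc using inCoords_smul hf hz hc

theorem isFinslerOn_sqInCoords (hn : 2 < n) {F : TangentBundle (𝓡 n) M → ℝ}
    (hF : IsFinslerMetric F) (p : M) : IsFinslerOn (slitDomain n p) (sqInCoords F p) := by
  have hU := isOpen_slitDomain (n := n) p
  have hs := smooth_inCoords hF.smooth p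
  have hL : ContDiffOn ℝ ∞ (sqInCoords F p) (slitDomain n p) := hs.pow 2
  have hmem : ∀ z ∈ slitDomain n p, ∀ y : 𝔼, y ≠ 0 → (z.1, y) ∈ slitDomain n p :=
    fun z hz y hy => mem_slitDomain.2 ⟨(mem_slitDomain.1 hz).1, hy⟩
  refine ⟨hU, fun z hz => hz.2, hL, fun z hz => ?_, fun z hz u hu => ?_⟩
  · have hd := (differentiableAt_of_smooth hU hs hz).hasFDerivAt.pow 2
    have e := DFunLike.congr_fun hd.fderiv (liouville z)
    refine e.trans ?_
    simp only [smul_apply, fderiv_inCoords_liouville hF.smooth hF.homogeneous hz, sqInCoords]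
    simp
    ring
  · refine hess_pos_of_nondegenerate (x := z.1) (by simp; omega) hU hL (hmem z hz) ?_ ?_ ?_
      hz.2 hu
    · intro y hy
      exact pow_pos (hF.pos _ (inducedChart_symm_snd_ne_zero (hmem z hz y hy))) 2
    · intro y hy c hc
      have := inCoords_smul hF.homogeneous (hmem z hz y hy) hc
      simp only [sqInCoords, this]
      ring
    · intro y hy u h
      refine hF.nondegenerate p _ (hmem z hz y hy) u fun w => ?_
      rw [metricTensor, h w, mul_zero]

theorem IsProjectiveFactor.isProjectiveOn (hn : 2 < n) {F F' P : TangentBundle (𝓡 n) M → ℝ}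
    (hF : IsFinslerMetric F) (hP : IsProjectiveFactor F F' P) (p : M) :
    IsProjectiveOn (slitDomain n p) (sprayVert (sqInCoords F p)) (sprayVert (sqInCoords F' p))
      (inCoords P p) where
  spray := (isFinslerOn_sqInCoords hn hF p).isSprayOn
  smooth := smooth_inCoords hP.smooth p
  euler z hz := by rw [fderiv_inCoords_liouville hP.smooth hP.homogeneous hz, one_smul]
  eq z hz := by rw [sprayVert, hP.spray_eq p z hz]; rfl

theorem hamelEquation_iff (hn : 2 < n) {F P : TangentBundle (𝓡 n) M → ℝ}
    (hF : IsFinslerMetric F) (hP : SmoothOnSlit P) :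
    HamelEquation F P ↔ ∀ p : M, ∀ z ∈ slitDomain n p, ∀ a b : 𝔼,
      hamelForm (sprayVert (sqInCoords F p)) (inCoords P p) z a b = 0 := by
  have key := fun (p : M) (z : 𝔼 × 𝔼) (hz : z ∈ slitDomain n p) (u w : 𝔼 × 𝔼) =>
    dEnd_horProj_spray (isFinslerOn_sqInCoords hn hF p) (smooth_inCoords hP p) hz u w
  constructor
  · intro h p z hz a b
    rw [← key p z hz (a, 0) (b, 0)]
    exact h p z hz _ _
  · intro h p z hz u w
    rw [key p z hz]
    exact h p z hz _ _

theorem IsProjectiveFactor.symm {F F' P : TangentBundle (𝓡 n) M → ℝ}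
    (hP : IsProjectiveFactor F F' P) : IsProjectiveFactor F' F (fun v => -P v) where
  smooth := hP.smooth.neg
  homogeneous x y hy c hc := by
    simp only [hP.homogeneous x y hy c hc, mul_neg]
  spray_eq p z hz := by
    rw [hP.spray_eq p z hz]
    simp [inCoords]

theorem IsProjectiveFactor.hamelEquation_symm_iff (hn : 2 < n)
    {F F' P : TangentBundle (𝓡 n) M → ℝ} (hF : IsFinslerMetric F) (hF' : IsFinslerMetric F')
    (hP : IsProjectiveFactor F F' P) :
    HamelEquation F' (fun v => -P v) ↔ HamelEquation F P := by
  rw [hamelEquation_iff hn hF' hP.symm.smooth, hamelEquation_iff hn hF hP.smooth]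
  have key : ∀ p : M, ∀ z ∈ slitDomain n p, ∀ a b : 𝔼,
      hamelForm (sprayVert (sqInCoords F' p)) (inCoords (fun v => -P v) p) z a b
        = -hamelForm (sprayVert (sqInCoords F p)) (inCoords P p) z a b := by
    intro p z hz a b
    rw [← (hP.isProjectiveOn hn hF p).hamelForm_eq hz, ← hamelForm_neg]
    rfl
  constructor
  · intro h p z hz a b
    rw [← neg_eq_zero, ← key p z hz, h p z hz]
  · intro h p z hz a b
    rw [key p z hz, h p z hz, neg_zero]

/-! ### Change of induced coordinates -/

/-- The change of coordinates of `M` between the charts at `p` and `q`. -/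
def transMap (n : ℕ) {M : Type*} [TopologicalSpace M]
    [ChartedSpace (EuclideanSpace ℝ (Fin n)) M] (p q : M) :
    EuclideanSpace ℝ (Fin n) → EuclideanSpace ℝ (Fin n) :=
  extChartAt (𝓡 n) q ∘ (extChartAt (𝓡 n) p).symm

/-- The coordinates, in the chart at `p`, of the points that lie in the chart at `q`. -/
def transDomain (n : ℕ) {M : Type*} [TopologicalSpace M]
    [ChartedSpace (EuclideanSpace ℝ (Fin n)) M] (p q : M) : Set (EuclideanSpace ℝ (Fin n)) :=
  (extChartAt (𝓡 n) p).target ∩ (extChartAt (𝓡 n) p).symm ⁻¹' (extChartAt (𝓡 n) q).source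

omit [IsManifold (𝓡 n) ∞ M] in
theorem isOpen_transDomain (p q : M) : IsOpen (transDomain n p q) :=
  (continuousOn_extChartAt_symm p).isOpen_inter_preimage (isOpen_extChartAt_target p)
    (isOpen_extChartAt_source q)

theorem smooth_transMap (p q : M) : ContDiffOn ℝ ∞ (transMap n p q) (transDomain n p q) := by
  have h := contDiffOn_ext_coord_change (I := 𝓡 n) (n := ∞) q p
  rwa [PartialEquiv.trans_source, PartialEquiv.symm_source] at h

theorem fderiv_transMap {p q : M} {x : 𝔼} (hx : x ∈ transDomain n p q) :
    fderiv ℝ (transMap n p q) x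
      = tangentCoordChange (𝓡 n) p q ((extChartAt (𝓡 n) p).symm x) := by
  rw [tangentCoordChange_def, (extChartAt (𝓡 n) p).right_inv hx.1]
  simp only [modelWithCornersSelf_coe, Set.range_id, fderivWithin_univ]
  rfl

theorem tangMap_transMap {p q : M} {z : 𝔼 × 𝔼} (hz : z.1 ∈ transDomain n p q) :
    tangMap (transMap n p q) z = inducedChart q ((inducedChart p).symm z) := by
  have hx := (extChartAt (𝓡 n) p).map_target hz.1
  rw [tangMap, fderiv_transMap hz, inducedChart_symm_apply, inducedChart_apply]
  refine Prod.ext rfl ?_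
  exact (tangentCoordChange_comp (I := 𝓡 n) ⟨⟨hx, mem_extChartAt_source _⟩, hz.2⟩).symm

theorem surjective_fderiv_transMap {p q : M} {x : 𝔼} (hx : x ∈ transDomain n p q) :
    Function.Surjective (fderiv ℝ (transMap n p q) x) := by
  have hp := (extChartAt (𝓡 n) p).map_target hx.1
  intro w
  refine ⟨tangentCoordChange (𝓡 n) q p ((extChartAt (𝓡 n) p).symm x) w, ?_⟩
  rw [fderiv_transMap hx, tangentCoordChange_comp (I := 𝓡 n) ⟨⟨hx.2, hp⟩, hx.2⟩,
    tangentCoordChange_self hx.2]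

theorem tangMap_transMap_mem {p q : M} {z : 𝔼 × 𝔼} (hz : z ∈ slitDomain n p)
    (hzq : z.1 ∈ transDomain n p q) : tangMap (transMap n p q) z ∈ slitDomain n q := by
  rw [tangMap_transMap hzq]
  exact inducedChart_mem_slitDomain hzq.2 (inducedChart_symm_snd_ne_zero hz)

theorem inCoords_tangMap (f : TangentBundle (𝓡 n) M → ℝ) {p q : M} {z : 𝔼 × 𝔼}
    (hz : z.1 ∈ transDomain n p q) :
    inCoords f q (tangMap (transMap n p q) z) = inCoords f p z := by
  have hmem : (inducedChart p).symm z ∈ (inducedChart (n := n) q).source :=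
    mem_inducedChart_source.2 hz.2
  rw [tangMap_transMap hz, inCoords, inCoords, (inducedChart q).left_inv hmem]

/-- The factor `(κ F² + P² - S P) / F̃²` does not depend on the coordinates. -/
theorem projFactor_tangMap (hn : 2 < n) {F F' P : TangentBundle (𝓡 n) M → ℝ}
    (hF : IsFinslerMetric F) (hP : SmoothOnSlit P) (κ : ℝ) {p q : M} {z : 𝔼 × 𝔼}
    (hz : z ∈ slitDomain n p) (hzq : z.1 ∈ transDomain n p q) :
    projFactor κ (sqInCoords F q) (sqInCoords F' q) (inCoords P q) (tangMap (transMap n p q) z)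
      = projFactor κ (sqInCoords F p) (sqInCoords F' p) (inCoords P p) z := by
  have hV := isOpen_transDomain (n := n) p q
  have hφ := smooth_transMap (n := n) p q
  have hS := spray_tangMap hV hφ (isFinslerOn_sqInCoords hn hF p) (isFinslerOn_sqInCoords hn hF q)
    (fun z hz hzq => tangMap_transMap_mem hz hzq)
    (fun z _ hzq => by simp only [sqInCoords, inCoords_tangMap F hzq])
    hz hzq (surjective_fderiv_transMap hzq)
  have hW : IsOpen (slitDomain n p ∩ Prod.fst ⁻¹' transDomain n p q) :=
    (isOpen_slitDomain p).inter (hV.preimage continuous_fst)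
  have hd : fderiv ℝ (inCoords P p) z
      = (fderiv ℝ (inCoords P q) (tangMap (transMap n p q) z)).comp
        (fderiv ℝ (tangMap (transMap n p q)) z) := by
    rw [← fderiv_congr_on hW (fun z hz => inCoords_tangMap P hz.2) ⟨hz, hzq⟩]
    exact fderiv_comp z
      (differentiableAt_of_smooth (isOpen_slitDomain q) (smooth_inCoords hP q)
        (tangMap_transMap_mem hz hzq))
      (differentiableAt_of_smooth (hV.preimage continuous_fst) (smooth_tangMap hV hφ) hzq)
  simp only [projFactor, sqInCoords, inCoords_tangMap F hzq, inCoords_tangMap F' hzq,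
    inCoords_tangMap P hzq]
  rw [hd, ContinuousLinearMap.comp_apply, ← hS]

/-! ### Globalisation -/

/-- A function given in all induced charts, with vanishing derivative and compatible with changes
of coordinates, is constant on `T₀M`. -/
theorem exists_const_of_fderiv_eq_zero (hn : 1 < n) [ConnectedSpace M] {K : M → 𝔼 × 𝔼 → ℝ}
    (hd : ∀ p, DifferentiableOn ℝ (K p) (slitDomain n p))
    (hK : ∀ p, ∀ z ∈ slitDomain n p, fderiv ℝ (K p) z = 0)
    (hc : ∀ p q, ∀ z ∈ slitDomain n p, z.1 ∈ transDomain n p q →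
      K q (tangMap (transMap n p q) z) = K p z) :
    ∃ k : ℝ, ∀ p, ∀ z ∈ slitDomain n p, K p z = k := by
  have hrank : 1 < Module.rank ℝ 𝔼 := by
    rw [← Module.finrank_eq_rank]
    simpa using hn
  have : Nontrivial 𝔼 := Module.nontrivial_of_finrank_pos (R := ℝ) (by simp; omega)
  obtain ⟨e, he⟩ := exists_ne (0 : 𝔼)
  have hconn : IsPreconnected ({0}ᶜ : Set 𝔼) :=
    (isConnected_compl_singleton_of_one_lt_rank hrank 0).isPreconnected
  -- near each point, `K` is constant over a ball of the chart
  have hball : ∀ p : M, ∀ x ∈ (extChartAt (𝓡 n) p).target, ∃ W ∈ nhds x,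
      W ⊆ (extChartAt (𝓡 n) p).target ∧ ∀ x' ∈ W, ∀ y y' : 𝔼, y ≠ 0 → y' ≠ 0 →
        K p (x', y) = K p (x, y') := by
    intro p x hx
    obtain ⟨r, hr, hsub⟩ := Metric.isOpen_iff.1 (isOpen_extChartAt_target (I := 𝓡 n) p) x hx
    refine ⟨Metric.ball x r, Metric.ball_mem_nhds x hr, hsub, fun x' hx' y y' hy hy' => ?_⟩
    have hsub' : Metric.ball x r ×ˢ ({0}ᶜ : Set 𝔼) ⊆ slitDomain n p := by
      rw [slitDomain_eq_prod]
      exact Set.prod_mono_left hsub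
    have hopen := (Metric.isOpen_ball (x := x) (ε := r)).prod
      (isOpen_compl_singleton (x := (0 : 𝔼)))
    obtain ⟨k, hk⟩ := hopen.exists_is_const_of_fderiv_eq_zero
      ((convex_ball x r).isPreconnected.prod hconn) ((hd p).mono hsub')
      (fun z hz => hK p z (hsub' hz))
    rw [hk (x', y) ⟨hx', hy⟩, hk (x, y') ⟨Metric.mem_ball_self hr, hy'⟩]
  have hfib : ∀ p : M, ∀ z ∈ slitDomain n p, ∀ y : 𝔼, y ≠ 0 → K p z = K p (z.1, y) := by
    intro p z hz y hy
    rw [mem_slitDomain] at hz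
    obtain ⟨W, hW, -, h⟩ := hball p z.1 hz.1
    exact h z.1 (mem_of_mem_nhds hW) z.2 y hz.2 hy
  set k : M → ℝ := fun x => K x (extChartAt (𝓡 n) x x, e) with hk
  have hkp : ∀ p : M, ∀ z ∈ slitDomain n p, K p z = k ((extChartAt (𝓡 n) p).symm z.1) := by
    intro p z hz
    set q := (extChartAt (𝓡 n) p).symm z.1 with hq
    have hzq : z.1 ∈ transDomain n p q := ⟨(mem_slitDomain.1 hz).1, mem_extChartAt_source q⟩
    rw [← hc p q z hz hzq, hfib q _ (tangMap_transMap_mem hz hzq) e he]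
    rfl
  have hloc : IsLocallyConstant k := by
    rw [IsLocallyConstant.iff_eventually_eq]
    intro x
    obtain ⟨W, hW, hWt, h⟩ := hball x (extChartAt (𝓡 n) x x) (mem_extChartAt_target x)
    filter_upwards [(continuousAt_extChartAt (I := 𝓡 n) x).preimage_mem_nhds hW,
      extChartAt_source_mem_nhds (I := 𝓡 n) x] with x' hx' hx's
    have h1 := hkp x (extChartAt (𝓡 n) x x', e) (mem_slitDomain.2 ⟨hWt hx', he⟩)
    rw [(extChartAt (𝓡 n) x).left_inv hx's] at h1
    rw [← h1, h _ hx' e e he he]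
  obtain ⟨x₀⟩ := (inferInstance : Nonempty M)
  exact ⟨k x₀, fun p z hz => by rw [hkp p z hz, hloc.apply_eq_of_preconnectedSpace _ x₀]⟩

theorem IsProjectiveFactor.hasConstantFlagCurvature_of_hamel (hn : 2 < n) [ConnectedSpace M]
    {F F' P : TangentBundle (𝓡 n) M → ℝ} (hF : IsFinslerMetric F) (hF' : IsFinslerMetric F')
    (hP : IsProjectiveFactor F F' P) (hc : HasConstantFlagCurvature F)
    (hH : HamelEquation F P) : HasConstantFlagCurvature F' := by
  obtain ⟨κ, hκ⟩ := hc
  rw [hamelEquation_iff hn hF hP.smooth] at hH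
  have hL := isFinslerOn_sqInCoords hn hF
  have hL' := isFinslerOn_sqInCoords hn hF'
  have hn' : 2 < Module.finrank ℝ 𝔼 := by simpa using hn
  obtain ⟨k, hk⟩ := exists_const_of_fderiv_eq_zero (n := n) (M := M) (by omega)
    (K := fun p => projFactor κ (sqInCoords F p) (sqInCoords F' p) (inCoords P p))
    (fun p => (smooth_projFactor (hL p) (hL' p) (smooth_inCoords hP.smooth p)).differentiableOn
      (by simp))
    (fun p z hz => fderiv_projFactor hn' (hL p) (hL' p) (hP.isProjectiveOn hn hF p) (hκ p)
      (hH p) hz)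
    (fun p q z hz hzq => projFactor_tangMap hn hF hP.smooth κ hz hzq)
  refine ⟨k, fun p z hz X hX => ?_⟩
  rw [← hk p z hz]
  exact flagCurvature_eq_projFactor (hL p) (hL' p) (hP.isProjectiveOn hn hF p) (hκ p) (hH p) hz hX

theorem IsProjectiveFactor.hamelEquation_of_hasConstantFlagCurvature (hn : 2 < n)
    {F F' P : TangentBundle (𝓡 n) M → ℝ} (hF : IsFinslerMetric F) (hF' : IsFinslerMetric F')
    (hP : IsProjectiveFactor F F' P) (hc : HasConstantFlagCurvature F)
    (hc' : HasConstantFlagCurvature F') : HamelEquation F P := by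
  obtain ⟨κ, hκ⟩ := hc
  obtain ⟨κ', hκ'⟩ := hc'
  rw [hamelEquation_iff hn hF hP.smooth]
  intro p z hz
  exact hamelForm_eq_zero_of_flagCurvature_eq (by simpa using hn) (isFinslerOn_sqInCoords hn hF p)
    (isFinslerOn_sqInCoords hn hF' p) (hP.isProjectiveOn hn hF p) (hκ p) (hκ' p) hz

end Manifold

end Finsler

end

theorem mainTheorem4 {n : ℕ} (hn : 2 < n) {M : Type*} [TopologicalSpace M]
    [ChartedSpace (EuclideanSpace ℝ (Fin n)) M] [IsManifold (𝓡 n) ∞ M] [ConnectedSpace M]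
    (F F' P : TangentBundle (𝓡 n) M → ℝ)
    (hF : Finsler.IsFinslerMetric F) (hF' : Finsler.IsFinslerMetric F')
    (hP : Finsler.IsProjectiveFactor F F' P) :
    (Finsler.HasConstantFlagCurvature F →
      (Finsler.HasConstantFlagCurvature F' ↔ Finsler.HamelEquation F P)) ∧
    (Finsler.HasConstantFlagCurvature F' →
      (Finsler.HasConstantFlagCurvature F ↔ Finsler.HamelEquation F P)) := by
  refine ⟨fun hc => ⟨fun hc' => ?_, fun hH => ?_⟩, fun hc' => ⟨fun hc => ?_, fun hH => ?_⟩⟩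
  · exact hP.hamelEquation_of_hasConstantFlagCurvature hn hF hF' hc hc'
  · exact hP.hasConstantFlagCurvature_of_hamel hn hF hF' hc hH
  · exact hP.hamelEquation_of_hasConstantFlagCurvature hn hF hF' hc hc'
  · -- the roles of the two metrics are exchanged by `P ↦ -P`, which preserves Hamel's equation
    exact hP.symm.hasConstantFlagCurvature_of_hamel hn hF' hF hc'
      ((hP.hamelEquation_symm_iff hn hF hF').2 hH)
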